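/- **Conventions.** For $n\ge 1$ let $\mathsf{scpx}_{\neq\emptyset}(n)$ be the set of non-empty simplicial complexes on $[n]=\{1,\dots,n\}$, i.e. of non-empty downward closed families of subsets of $[n]$ (ghost vertices and $\{\emptyset\}$ are allowed); there are no operations of arity $0$. For $I\subseteq[n]$, $J\subseteq[m]$, $k\in[n]$ put $$I\circ^c_kJ=\begin{cases}I^{<k}\sqcup([m]+k-1)\sqcup(I^{>k}+m-1)&k\in I,\\ I^{<k}\sqcup(J+k-1)\sqcup(I^{>k}+m-1)&k\notin I,\end{cases}$$ and let $K\circ^c_kL$ be the downward closure of $\{I\circ^c_kJ\mid I\in K,J\in L\}$. With the right actions $K\cdot\sigma=\{\sigma^{-1}(I)\mid I\in K\}$ and the unit $\{\emptyset\}\in\mathsf{scpx}_{\neq\emptyset}(1)$ this is a symmetric set operad, the composition operad $(\mathsf{scpx}_{\neq\emptyset},\{\circ^c_k\})$. An algebra over a set operad on a set $S$ is a morphism of operads to the endomorphism operad $\mathrm{End}_S(n)=\mathrm{Map}(S^n,S)$, where $(h\cdot\sigma)(x_1,\dots,x_n)=h(x_{\sigma^{-1}(1)},\dots,x_{\sigma^{-1}(n)})$.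 Let $(\mathrm C,\otimes,e)$ be a symmetric monoidal category (not necessarily strict or small) such that, for every non-empty simplicial complex $K$, colimits indexed by the face poset $\operatorname{cat}(K)=(K,\subseteq)$ exist in $\mathrm C$ and are preserved by $\otimes$ in each variable (for example, $\mathrm C$ cocomplete with $\otimes$ cocontinuous in each variable). For arrows $\underline f=(f_i\colon Y_i\to X_i)_{i\in[n]}$ of $\mathrm C$ let $\mathcal z_n(-;\underline f)\colon(\wp([n]),\subseteq)\to\mathrm C$ be the cubical functor $\mathcal z_n(I;\underline f)=\bigotimes_{i=1}^nZ_i^I$, with $Z_i^I=X_i$ if $i\in I$ and $Z_i^I=Y_i$ otherwise, sending $I\subseteq J$ to the tensor product of the maps $f_i$ ($i\in J\setminus I$) and identities (the others). For $K\in\mathsf{scpx}_{\neq\emptyset}(n)$ let $$\overrightarrow{\mathcal Z}{}^c_n(K;\underline f):=\Bigl(\operatorname*{colim}_{I\in\operatorname{cat}(K)}\mathcal z_n(I;\underline f)\longrightarrow\mathcal z_n([n];\underline f)=\bigotimes_{j=1}^nX_j\Bigr)$$ be the canonical morphism. It is a functor of $\underline f\in\mathrm{Arr}(\mathrm C)^n$,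 where $\mathrm{Arr}(\mathrm C)$ is the category of arrows and commutative squares. **Theorem.** The maps $\overrightarrow{\mathcal Z}{}^c_n$ make the arrows of $\mathrm C$ into an algebra over $(\mathsf{scpx}_{\neq\emptyset},\{\circ^c_k\})$, up to natural isomorphism. Precisely, there are isomorphisms in $\mathrm{Arr}(\mathrm C)$, natural in $\underline f$, as follows. 1. (Unit) $\overrightarrow{\mathcal Z}{}^c_1(\{\emptyset\};f)\cong f$. 2. (Equivariance) $\overrightarrow{\mathcal Z}{}^c_n(K\cdot\sigma;f_1,\dots,f_n)\cong\overrightarrow{\mathcal Z}{}^c_n(K;f_{\sigma^{-1}(1)},\dots,f_{\sigma^{-1}(n)})$ for all $K\in\mathsf{scpx}_{\neq\emptyset}(n)$ and $\sigma\in\mathbb S_n$. 3. (Composition) For all $K\in\mathsf{scpx}_{\neq\emptyset}(n)$, $L\in\mathsf{scpx}_{\neq\emptyset}(m)$ and $k\in[n]$, $$\overrightarrow{\mathcal Z}{}^c_{n+m-1}(K\circ^c_kL;\underline f)\cong\overrightarrow{\mathcal Z}{}^c_n\bigl(K;f_1,\dots,f_{k-1},\overrightarrow{\mathcal Z}{}^c_m(L;f_k,\dots,f_{k+m-1}),f_{k+m},\dots,f_{n+m-1}\bigr).$$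 On domains, this is the composition formula for polyhedral products in $\mathrm C$. In 1 and 3 the isomorphism of codomains is a structural one, built from identities, associators and unitors by $\otimes$ and composition (so it is an identity if $\mathrm C$ is strict); in 2 it is built from these and the symmetries. In particular $([f_1],\dots,[f_n])\mapsto[\overrightarrow{\mathcal Z}{}^c_n(K;\underline f)]$ is well defined and is an algebra over $(\mathsf{scpx}_{\neq\emptyset},\{\circ^c_k\})$, in the strict set-theoretic sense, on the set (class) of isomorphism classes of arrows of $\mathrm C$. -/

import Mathlib

open CategoryTheory MonoidalCategory Limits

universe w v u

/-! ### Inputs of a partial composition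

All positions are numbered from `0`, so `[n]` is `Fin n`. When an operation with `m` inputs is
plugged into the input `k` of an operation with `n` inputs, the `n + m - 1` inputs of the result
are those of the inner operation (placed at `k, ..., k + m - 1`) and the inputs `i ≠ k` of the outer
one (kept if `i < k`, moved to `i + m - 1` if `i > k`). -/

/-- The position, in the composite, of the input `j` of the inner operation. -/
def blockIdx {n m : ℕ} (k : Fin n) (j : Fin m) : Fin (n + m - 1) :=
  ⟨k.val + j.val, by omega⟩

/-- The position, in the composite, of the input `i ≠ k` of the outer operation. -/
def outIdx {n : ℕ} (m : ℕ) (k i : Fin n) (h : i ≠ k) : Fin (n + m - 1) :=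
  ⟨if i.val < k.val then i.val else i.val + m - 1, by
    have : i.val ≠ k.val := fun e => h (Fin.ext e)
    split_ifs <;> omega⟩

@[simp] lemma blockIdx_val {n m : ℕ} (k : Fin n) (j : Fin m) :
    (blockIdx k j).val = k.val + j.val := rfl

@[simp] lemma outIdx_val {n : ℕ} (m : ℕ) (k i : Fin n) (h : i ≠ k) :
    (outIdx m k i h).val = if i.val < k.val then i.val else i.val + m - 1 := rfl

lemma blockIdx_injective {n m : ℕ} (k : Fin n) :
    Function.Injective (blockIdx k : Fin m → Fin (n + m - 1)) := by
  intro a b h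
  have := congrArg Fin.val h
  simp only [blockIdx_val] at this
  exact Fin.ext (by omega)

lemma outIdx_injective {n m : ℕ} (k i i' : Fin n) (h : i ≠ k) (h' : i' ≠ k)
    (e : outIdx m k i h = outIdx m k i' h') : i = i' := by
  have := congrArg Fin.val e
  have h1 : i.val ≠ k.val := fun e => h (Fin.ext e)
  have h2 : i'.val ≠ k.val := fun e => h' (Fin.ext e)
  simp only [outIdx_val] at this
  apply Fin.ext
  split_ifs at this <;> omega

lemma outIdx_ne_blockIdx {n m : ℕ} (k i : Fin n) (h : i ≠ k) (j : Fin m) :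
    outIdx m k i h ≠ blockIdx k j := by
  intro e
  have := congrArg Fin.val e
  have h1 : i.val ≠ k.val := fun e => h (Fin.ext e)
  simp only [outIdx_val, blockIdx_val] at this
  split_ifs at this <;> omega

lemma exists_idx {n m : ℕ} (k : Fin n) (x : Fin (n + m - 1)) :
    (∃ j : Fin m, x = blockIdx k j) ∨ ∃ (i : Fin n) (h : i ≠ k), x = outIdx m k i h := by
  by_cases h1 : x.val < k.val
  · refine Or.inr ⟨⟨x.val, by omega⟩, fun e => ?_, Fin.ext ?_⟩
    · have := congrArg Fin.val e
      simp only at this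
      omega
    · simp [h1]
  · by_cases h2 : x.val < k.val + m
    · exact Or.inl ⟨⟨x.val - k.val, by omega⟩, Fin.ext (by simp only [blockIdx_val]; omega)⟩
    · refine Or.inr ⟨⟨x.val + 1 - m, by omega⟩, fun e => ?_, Fin.ext ?_⟩
      · have := congrArg Fin.val e
        simp only at this
        omega
      · simp only [outIdx_val]
        rw [if_neg (by omega)]
        omega

/-- The inputs of the composite are the inputs `≠ k` of the outer operation and the inputs of the
inner one. -/
noncomputable def idxEquiv {n : ℕ} (m : ℕ) (k : Fin n) :
    {i : Fin n // i ≠ k} ⊕ Fin m ≃ Fin (n + m - 1) :=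
  Equiv.ofBijective (Sum.elim (fun i => outIdx m k i.1 i.2) (blockIdx k)) <| by
    constructor
    · rintro (⟨i, hi⟩ | j) (⟨i', hi'⟩ | j') h
      · exact congrArg Sum.inl (Subtype.ext (outIdx_injective k i i' hi hi' h))
      · exact absurd h (outIdx_ne_blockIdx k i hi j')
      · exact absurd h.symm (outIdx_ne_blockIdx k i' hi' j)
      · exact congrArg Sum.inr (blockIdx_injective k h)
    · intro x
      rcases exists_idx k x with ⟨j, rfl⟩ | ⟨i, h, rfl⟩
      · exact ⟨Sum.inr j, rfl⟩
      · exact ⟨Sum.inl ⟨i, h⟩, rfl⟩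

/-- The block permutation `σ ∘_k τ`: it moves the block at `k` to the block at `σ k`, permuting it
internally by `τ`, and moves the other inputs according to `σ`. -/
noncomputable def blockPerm {n m : ℕ} (k : Fin n) (σ : Equiv.Perm (Fin n))
    (τ : Equiv.Perm (Fin m)) : Equiv.Perm (Fin (n + m - 1)) :=
  (idxEquiv m k).symm.trans
    ((Equiv.sumCongr (σ.subtypeEquiv fun i => (σ.injective.ne_iff (x := i) (y := k)).symm) τ).trans
      (idxEquiv m (σ k)))

lemma blockPerm_block {n m : ℕ} (k : Fin n) (σ : Equiv.Perm (Fin n))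
    (τ : Equiv.Perm (Fin m)) (j : Fin m) :
    blockPerm k σ τ (blockIdx k j) = blockIdx (σ k) (τ j) := by
  have : (idxEquiv m k).symm (blockIdx k j) = Sum.inr j := by
    rw [Equiv.symm_apply_eq]; rfl
  simp only [blockPerm, Equiv.trans_apply, this]
  rfl

lemma blockPerm_out {n m : ℕ} (k : Fin n) (σ : Equiv.Perm (Fin n))
    (τ : Equiv.Perm (Fin m)) (i : Fin n) (h : i ≠ k) :
    blockPerm k σ τ (outIdx m k i h) = outIdx m (σ k) (σ i) (σ.injective.ne h) := by
  have : (idxEquiv m k).symm (outIdx m k i h) = Sum.inl ⟨i, h⟩ := by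
    rw [Equiv.symm_apply_eq]; rfl
  simp only [blockPerm, Equiv.trans_apply, this]
  rfl

/-! ### Set operads -/

/-- Unital symmetric set operads, with right actions `A · σ` of the symmetric groups and partial
compositions `A ∘_k B`. Heterogeneous equality only accounts for the equalities between arities such
as `(l + n - 1) + m - 1 = (l + m - 1) + n - 1`. -/
structure SetOperad where
  Op : ℕ → Type w
  act : ∀ {n : ℕ}, Op n → Equiv.Perm (Fin n) → Op n
  comp : ∀ {n m : ℕ}, Fin n → Op n → Op m → Op (n + m - 1)
  unit : Op 1
  act_one : ∀ {n : ℕ} (A : Op n), act A 1 = A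
  act_mul : ∀ {n : ℕ} (A : Op n) (σ τ : Equiv.Perm (Fin n)), act A (σ * τ) = act (act A σ) τ
  unit_comp : ∀ {n : ℕ} (A : Op n), HEq (comp 0 unit A) A
  comp_unit : ∀ {n : ℕ} (A : Op n) (k : Fin n), HEq (comp k A unit) A
  parallel : ∀ {l n m : ℕ} (A : Op l) (B : Op n) (C : Op m) (i j : Fin l) (h : i < j),
    HEq (comp (outIdx n i j h.ne') (comp i A B) C) (comp (outIdx m j i h.ne) (comp j A C) B)
  sequential : ∀ {l n m : ℕ} (A : Op l) (B : Op n) (C : Op m) (i : Fin l) (j : Fin n),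
    HEq (comp i A (comp j B C)) (comp (blockIdx i j) (comp i A B) C)
  equivariance : ∀ {n m : ℕ} (A : Op n) (B : Op m) (k : Fin n) (σ : Equiv.Perm (Fin n))
    (τ : Equiv.Perm (Fin m)),
    comp k (act A σ) (act B τ) = act (comp (σ k) A B) (blockPerm k σ τ)

/-- Morphisms of (unital, symmetric) set operads. -/
structure SetOperad.Hom (P : SetOperad.{w}) (Q : SetOperad.{v}) where
  map : ∀ {n : ℕ}, P.Op n → Q.Op n
  map_act : ∀ {n : ℕ} (A : P.Op n) (σ : Equiv.Perm (Fin n)), map (P.act A σ) = Q.act (map A) σ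
  map_unit : map P.unit = Q.unit
  map_comp : ∀ {n m : ℕ} (k : Fin n) (A : P.Op n) (B : P.Op m),
    map (P.comp k A B) = Q.comp k (map A) (map B)

/-- `f ∘_k g`: the inputs `k, ..., k + m - 1` are fed to `g`, whose value is the input `k` of `f`;
the remaining inputs are those of `f`. -/
def endComp (X : Type w) {n m : ℕ} (k : Fin n) (f : (Fin n → X) → X) (g : (Fin m → X) → X) :
    (Fin (n + m - 1) → X) → X :=
  fun x => f fun i => if h : i = k then g fun j => x (blockIdx k j) else x (outIdx m k i h)

lemma heq_endOp {X : Type w} {a b : ℕ} (e : a = b) (f : (Fin a → X) → X) (g : (Fin b → X) → X)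
    (h : ∀ x : Fin b → X, f (fun i => x (Fin.cast e i)) = g x) : HEq f g := by
  subst e
  exact heq_of_eq (funext h)

/-- The endomorphism operad of a set `X`, with `(f · σ) (x) = f (σ · x)` where
`(σ · x)_i = x_{σ⁻¹ i}`. -/
def endOperad (X : Type w) : SetOperad.{w} where
  Op n := (Fin n → X) → X
  act f σ := fun x => f fun i => x (σ⁻¹ i)
  comp := endComp X
  unit := fun x => x 0
  act_one _ := rfl
  act_mul f σ τ := by
    funext x
    simp [mul_inv_rev]
  unit_comp {n} f := by
    refine heq_endOp (by omega) _ _ fun x => ?_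
    simp only [endComp, dite_true]
    congr 1
    funext j
    congr 1
    exact Fin.ext (by simp)
  comp_unit {n} f k := by
    refine heq_endOp (by omega) _ _ fun x => ?_
    simp only [endComp]
    congr 1
    funext i
    split_ifs with h
    · subst h
      congr 1
    · congr 1
      exact Fin.ext (by simp)
  parallel {l n m} A B C i j h := by
    have hij : i.val < j.val := h
    have hj := j.2
    refine heq_endOp (by omega) _ _ fun x => ?_
    simp only [endComp]
    congr 1
    funext p
    by_cases hpi : p = i
    · subst hpi
      have hpj : p ≠ j := h.ne
      simp only [dite_true, hpj, dite_false]
      congr 1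
      funext q
      rw [dif_neg (fun e => outIdx_ne_blockIdx _ _ _ _ e.symm)]
      congr 1
      apply Fin.ext
      have := q.2
      simp only [Fin.val_cast, outIdx_val, blockIdx_val]
      split_ifs <;> omega
    · by_cases hpj : p = j
      · subst hpj
        simp only [dite_true, hpi, dite_false]
        congr 1
        funext q
        rw [dif_neg (fun e => outIdx_ne_blockIdx _ _ _ _ e.symm)]
        congr 1
        apply Fin.ext
        have := q.2
        simp only [Fin.val_cast, outIdx_val, blockIdx_val]
        split_ifs <;> omega
      · simp only [hpi, hpj, dite_false]
        rw [dif_neg (fun e => hpj (outIdx_injective _ _ _ _ _ e)),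
          dif_neg (fun e => hpi (outIdx_injective _ _ _ _ _ e))]
        congr 1
        apply Fin.ext
        have h1 : p.val ≠ i.val := fun e => hpi (Fin.ext e)
        have h2 : p.val ≠ j.val := fun e => hpj (Fin.ext e)
        simp only [Fin.val_cast, outIdx_val]
        split_ifs <;> omega
  sequential {l n m} A B C i j := by
    have hi := i.2
    have hj := j.2
    refine heq_endOp (by omega) _ _ fun x => ?_
    simp only [endComp]
    congr 1
    funext p
    by_cases hpi : p = i
    · subst hpi
      simp only [dite_true]
      congr 1
      funext q
      by_cases hq : q = j
      · subst hq
        simp only [dite_true]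
        congr 1
        funext c
        congr 1
        apply Fin.ext
        simp only [Fin.val_cast, blockIdx_val]
        omega
      · simp only [hq, dite_false]
        rw [dif_neg (fun e => hq (blockIdx_injective _ e))]
        congr 1
        apply Fin.ext
        have h2 : q.val ≠ j.val := fun e => hq (Fin.ext e)
        simp only [Fin.val_cast, blockIdx_val, outIdx_val]
        by_cases h3 : q.val < j.val
        · have h4 : p.val + q.val < p.val + j.val := by omega
          simp only [h3, h4, if_true]
        · have h4 : ¬ p.val + q.val < p.val + j.val := by omega
          simp only [h3, h4, if_false]
          omega
    · simp only [hpi, dite_false]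
      rw [dif_neg (fun e => outIdx_ne_blockIdx _ _ _ _ e)]
      congr 1
      apply Fin.ext
      have h2 : p.val ≠ i.val := fun e => hpi (Fin.ext e)
      have := j.2
      simp only [Fin.val_cast, blockIdx_val, outIdx_val]
      split_ifs <;> omega
  equivariance {n m} f g k σ τ := by
    funext x
    simp only [endComp]
    congr 1
    funext i
    obtain ⟨i, rfl⟩ := σ.surjective i
    have hs : σ⁻¹ (σ i) = i := σ.symm_apply_apply i
    by_cases hi : i = k
    · subst hi
      rw [dif_pos hs, dif_pos rfl]
      congr 1
      funext j
      obtain ⟨j, rfl⟩ := τ.surjective j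
      rw [← blockPerm_block]
      congr 1
      rw [show τ⁻¹ (τ j) = j from τ.symm_apply_apply j]
      exact (Equiv.symm_apply_apply (blockPerm i σ τ) _).symm
    · have hi' : σ i ≠ σ k := σ.injective.ne hi
      rw [dif_neg (by rw [hs]; exact hi), dif_neg hi', ← blockPerm_out _ _ τ _ hi]
      congr 1
      simp only [hs]
      exact (Equiv.symm_apply_apply (blockPerm k σ τ) _).symm

/-- An algebra structure over the set operad `P` on the set `X`. -/
abbrev SetOperad.Algebra (P : SetOperad.{w}) (X : Type v) := SetOperad.Hom P (endOperad X)

/-! ### The composition operad on non-empty simplicial complexes -/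

/-- Non-empty simplicial complexes on the vertex set `[n]`, for `n ≥ 1`: non-empty downward closed
families of subsets of `[n]`. Ghost vertices are allowed, as is the complex `{∅}`. -/
structure NonemptyScpx (n : ℕ) where
  pos : 0 < n
  faces : LowerSet (Finset (Fin n))
  nonempty : (faces : Set (Finset (Fin n))).Nonempty

/-- The composition `I ∘ᶜ_k J` of subsets: it is `I^{<k} ⊔ ([m] + k) ⊔ (I^{>k} + m - 1)` if `k ∈ I`
and `I^{<k} ⊔ (J + k) ⊔ (I^{>k} + m - 1)` if `k ∉ I`. -/
def subsetComp {n m : ℕ} (k : Fin n) (I : Finset (Fin n)) (J : Finset (Fin m)) :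
    Finset (Fin (n + m - 1)) :=
  Finset.univ.filter fun x =>
    (∃ i ∈ I, i < k ∧ x.val = i.val) ∨
    (∃ j : Fin m, (k ∈ I ∨ j ∈ J) ∧ x.val = j.val + k.val) ∨
    (∃ i ∈ I, k < i ∧ x.val = i.val + m - 1)

lemma blockIdx_mem_subsetComp {n m : ℕ} (k : Fin n) (I : Finset (Fin n)) (J : Finset (Fin m))
    (j : Fin m) : blockIdx k j ∈ subsetComp k I J ↔ k ∈ I ∨ j ∈ J := by
  simp only [subsetComp, Finset.mem_filter, Finset.mem_univ, true_and, blockIdx_val]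
  constructor
  · rintro (⟨i, _, h, e⟩ | ⟨j', h, e⟩ | ⟨i, _, h, e⟩)
    · have : i.val < k.val := h
      omega
    · have : j' = j := Fin.ext (by omega)
      exact this ▸ h
    · have : k.val < i.val := h
      omega
  · exact fun h => Or.inr (Or.inl ⟨j, h, by omega⟩)

lemma outIdx_mem_subsetComp {n m : ℕ} (k : Fin n) (I : Finset (Fin n)) (J : Finset (Fin m))
    (i : Fin n) (hi : i ≠ k) : outIdx m k i hi ∈ subsetComp k I J ↔ i ∈ I := by
  have h0 : i.val ≠ k.val := fun e => hi (Fin.ext e)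
  simp only [subsetComp, Finset.mem_filter, Finset.mem_univ, true_and, outIdx_val]
  constructor
  · rintro (⟨i', hI, h, e⟩ | ⟨j', _, e⟩ | ⟨i', hI, h, e⟩)
    · have : i'.val < k.val := h
      have : i' = i := Fin.ext (by split_ifs at e <;> omega)
      exact this ▸ hI
    · split_ifs at e <;> omega
    · have : k.val < i'.val := h
      have : i' = i := Fin.ext (by split_ifs at e <;> omega)
      exact this ▸ hI
  · intro hI
    by_cases h : i.val < k.val
    · exact Or.inl ⟨i, hI, h, by simp [h]⟩
    · exact Or.inr (Or.inr ⟨i, hI, Fin.lt_def.2 (by omega), by simp [h]⟩)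

namespace NonemptyScpx

lemma ext_faces {n : ℕ} {K L : NonemptyScpx n} (h : ∀ S, S ∈ K.faces ↔ S ∈ L.faces) : K = L := by
  cases K
  cases L
  congr
  exact SetLike.ext h

lemma empty_mem {n : ℕ} (K : NonemptyScpx n) : ∅ ∈ K.faces := by
  obtain ⟨I, hI⟩ := K.nonempty
  exact K.faces.lower (Finset.empty_subset I) hI

/-- The right action of permutations: `K · σ = {σ⁻¹ (I) | I ∈ K}`. -/
def act {n : ℕ} (K : NonemptyScpx n) (σ : Equiv.Perm (Fin n)) : NonemptyScpx n where
  pos := K.pos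
  faces :=
    { carrier := {S | ∃ I ∈ K.faces, S = I.map (σ⁻¹).toEmbedding}
      lower' := by
        rintro S T hTS ⟨I, hI, rfl⟩
        refine ⟨T.map σ.toEmbedding, K.faces.lower ?_ hI, ?_⟩
        · intro x hx
          obtain ⟨t, ht, rfl⟩ := Finset.mem_map.1 hx
          obtain ⟨y, hy, rfl⟩ := Finset.mem_map.1 (hTS ht)
          simpa using hy
        · rw [Finset.map_map]
          ext x
          simp }
  nonempty := ⟨_, ∅, K.empty_mem, rfl⟩

/-- The composition `K ∘ᶜ_k L`: the downward closure of `{I ∘ᶜ_k J | I ∈ K, J ∈ L}`. -/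
def comp {n m : ℕ} (k : Fin n) (K : NonemptyScpx n) (L : NonemptyScpx m) :
    NonemptyScpx (n + m - 1) where
  pos := by have := K.pos; have := L.pos; omega
  faces :=
    { carrier := {S | ∃ I ∈ K.faces, ∃ J ∈ L.faces, S ⊆ subsetComp k I J}
      lower' := by
        rintro S T hTS ⟨I, hI, J, hJ, h⟩
        exact ⟨I, hI, J, hJ, Finset.Subset.trans hTS h⟩ }
  nonempty := ⟨∅, ∅, K.empty_mem, ∅, L.empty_mem, Finset.empty_subset _⟩

/-- The unit: the complex `{∅}` on one vertex. -/
def unit : NonemptyScpx 1 where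
  pos := one_pos
  faces := LowerSet.Iic ∅
  nonempty := ⟨∅, le_refl (∅ : Finset (Fin 1))⟩

open Classical in
/-- The characteristic function of the non-faces, used to derive the operad axioms. -/
noncomputable def char {n : ℕ} (K : NonemptyScpx n) : (Fin n → Prop) → Prop :=
  fun s => Finset.univ.filter s ∉ K.faces

open Classical in
lemma char_injective {n : ℕ} {K L : NonemptyScpx n} (h : K.char = L.char) : K = L := by
  refine ext_faces fun S => ?_
  have := congrFun h (fun i => i ∈ S)
  simpa [char, not_iff_not] using this

lemma heq_of_char {a b : ℕ} (e : a = b) {K : NonemptyScpx a} {L : NonemptyScpx b}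
    (h : HEq K.char L.char) : HEq K L := by
  subst e
  exact heq_of_eq (char_injective (eq_of_heq h))

open Classical in
lemma char_act {n : ℕ} (K : NonemptyScpx n) (σ : Equiv.Perm (Fin n)) :
    (K.act σ).char = (endOperad Prop).act K.char σ := by
  funext s
  apply propext
  apply not_congr
  change (∃ I ∈ K.faces, Finset.univ.filter s = I.map (σ⁻¹).toEmbedding) ↔
    (Finset.univ.filter fun i => s (σ⁻¹ i)) ∈ K.faces
  constructor
  · rintro ⟨I, hI, e⟩
    convert hI using 1
    ext x
    have := Finset.ext_iff.1 e ((σ⁻¹ : Equiv.Perm (Fin n)) x)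
    have h2 := Finset.mem_map' (σ⁻¹).toEmbedding (a := x) (s := I)
    simpa using this.trans h2
  · intro h
    refine ⟨_, h, ?_⟩
    ext x
    obtain ⟨y, rfl⟩ := (σ⁻¹ : Equiv.Perm (Fin n)).surjective x
    have h2 := Finset.mem_map' (σ⁻¹).toEmbedding (a := y)
      (s := Finset.univ.filter fun i => s (σ⁻¹ i))
    refine Iff.trans ?_ h2.symm
    simp

open Classical in
lemma char_comp {n m : ℕ} (k : Fin n) (K : NonemptyScpx n) (L : NonemptyScpx m) :
    (comp k K L).char = (endOperad Prop).comp k K.char L.char := by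
  funext s
  apply propext
  apply not_congr
  refine Iff.trans (b := ∃ I ∈ K.faces, ∃ J ∈ L.faces, Finset.univ.filter s ⊆ subsetComp k I J)
    Iff.rfl ?_
  constructor
  · rintro ⟨I, hI, J, hJ, h⟩
    refine K.faces.lower ?_ hI
    intro i hi
    simp only [Finset.mem_filter, Finset.mem_univ, true_and] at hi
    split_ifs at hi with hik
    · subst hik
      by_contra hn
      refine hi (L.faces.lower ?_ hJ)
      intro j hj
      simp only [Finset.mem_filter, Finset.mem_univ, true_and] at hj
      have := (blockIdx_mem_subsetComp i I J j).1 (h (by simpa using hj))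
      exact this.resolve_left hn
    · exact (outIdx_mem_subsetComp k I J i hik).1 (h (by simpa using hi))
  · intro h
    by_cases hL : Finset.univ.filter (fun j => s (blockIdx k j)) ∈ L.faces
    · refine ⟨_, h, _, hL, ?_⟩
      intro x hx
      simp only [Finset.mem_filter, Finset.mem_univ, true_and] at hx
      rcases exists_idx k x with ⟨j, rfl⟩ | ⟨i, hi, rfl⟩
      · rw [blockIdx_mem_subsetComp]
        exact Or.inr (by simpa using hx)
      · rw [outIdx_mem_subsetComp]
        simpa [hi] using hx
    · refine ⟨_, h, ∅, L.empty_mem, ?_⟩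
      intro x hx
      simp only [Finset.mem_filter, Finset.mem_univ, true_and] at hx
      rcases exists_idx k x with ⟨j, rfl⟩ | ⟨i, hi, rfl⟩
      · rw [blockIdx_mem_subsetComp]
        refine Or.inl ?_
        simp only [Finset.mem_filter, Finset.mem_univ, true_and, dite_true]
        exact hL
      · rw [outIdx_mem_subsetComp]
        simpa [hi] using hx

open Classical in
lemma char_unit : unit.char = (endOperad Prop).unit := by
  funext s
  apply propext
  change ¬ (Finset.univ.filter s ≤ ∅) ↔ s 0
  simp [Finset.filter_eq_empty_iff]

end NonemptyScpx

/-- The composition operad on non-empty simplicial complexes. -/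
def compositionOperad : SetOperad.{0} where
  Op := NonemptyScpx
  act := NonemptyScpx.act
  comp := NonemptyScpx.comp
  unit := NonemptyScpx.unit
  act_one A := NonemptyScpx.char_injective <| by
    rw [NonemptyScpx.char_act]
    exact (endOperad Prop).act_one _
  act_mul A σ τ := NonemptyScpx.char_injective <| by
    simp only [NonemptyScpx.char_act]
    exact (endOperad Prop).act_mul _ _ _
  unit_comp A := NonemptyScpx.heq_of_char (by omega) <| by
    rw [NonemptyScpx.char_comp, NonemptyScpx.char_unit]
    exact SetOperad.unit_comp _ _
  comp_unit A k := NonemptyScpx.heq_of_char (by omega) <| by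
    rw [NonemptyScpx.char_comp, NonemptyScpx.char_unit]
    exact SetOperad.comp_unit _ _ _
  parallel A B C i j h := NonemptyScpx.heq_of_char
    (by have h1 : i.val < j.val := h; have h2 := j.2; omega) <| by
    simp only [NonemptyScpx.char_comp]
    exact SetOperad.parallel _ _ _ _ _ _ h
  sequential A B C i j := NonemptyScpx.heq_of_char
    (by have h1 := i.2; have h2 := j.2; omega) <| by
    simp only [NonemptyScpx.char_comp]
    exact SetOperad.sequential _ _ _ _ _ _
  equivariance A B k σ τ := NonemptyScpx.char_injective <| by
    simp only [NonemptyScpx.char_comp, NonemptyScpx.char_act]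
    exact (endOperad Prop).equivariance _ _ _ _ _

/-- The face category `cat(K)`: the poset of faces of `K`, ordered by inclusion. It contains `∅`
because `K` is non-empty. -/
abbrev NonemptyScpx.Face {n : ℕ} (K : NonemptyScpx n) : Type := {I : Finset (Fin n) // I ∈ K.faces}

/-! ### The cubical functor and the structure maps -/

section Polyhedral

variable {C : Type u} [Category.{v} C]

/-- The object `Y` (for `false`) or `X` (for `true`) of an arrow `Y ⟶ X`. -/
def edgeObj (f : Arrow C) : Bool → C
  | false => f.left
  | true => f.right

/-- The arrow `f : Y ⟶ X`, seen as a functor from `{false ≤ true}`: the identity of `Y`, `f`, or the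
identity of `X`. -/
def edgeHom (f : Arrow C) : (a b : Bool) → a ≤ b → (edgeObj f a ⟶ edgeObj f b)
  | false, false, _ => 𝟙 f.left
  | false, true, _ => f.hom
  | true, true, _ => 𝟙 f.right
  | true, false, h => absurd h (by decide)

/-- The components of a morphism of arrows. -/
def edgeMap {f g : Arrow C} (φ : f ⟶ g) : (a : Bool) → (edgeObj f a ⟶ edgeObj g a)
  | false => φ.left
  | true => φ.right

lemma edgeHom_refl (f : Arrow C) (a : Bool) (h : a ≤ a) : edgeHom f a a h = 𝟙 _ := by
  cases a <;> rfl

lemma edgeHom_comp (f : Arrow C) (a b c : Bool) (h : a ≤ b) (h' : b ≤ c) :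
    edgeHom f a b h ≫ edgeHom f b c h' = edgeHom f a c (h.trans h') := by
  cases a <;> cases b <;> cases c <;>
    first
    | exact absurd h (by decide)
    | exact absurd h' (by decide)
    | exact Category.id_comp _
    | exact Category.comp_id _

lemma edgeMap_id (f : Arrow C) (a : Bool) : edgeMap (𝟙 f) a = 𝟙 _ := by
  cases a <;> rfl

lemma edgeMap_comp {f g h : Arrow C} (φ : f ⟶ g) (ψ : g ⟶ h) (a : Bool) :
    edgeMap (φ ≫ ψ) a = edgeMap φ a ≫ edgeMap ψ a := by
  cases a <;> rfl

lemma edgeHom_naturality {f g : Arrow C} (φ : f ⟶ g) (a b : Bool) (h : a ≤ b) :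
    edgeHom f a b h ≫ edgeMap φ b = edgeMap φ a ≫ edgeHom g a b h := by
  cases a <;> cases b <;>
    first
    | exact absurd h (by decide)
    | exact (Category.id_comp _).trans (Category.comp_id _).symm
    | exact (Arrow.w φ).symm

lemma decide_mem_le {n : ℕ} {I J : Finset (Fin n)} (h : I ≤ J) (i : Fin n) :
    decide (i ∈ I) ≤ decide (i ∈ J) := by
  by_cases hI : i ∈ I
  · simp [hI, Finset.mem_of_subset h hI]
  · simp [hI]

variable [MonoidalCategory C]

/-- The iterated tensor product `X 0 ⊗ (X 1 ⊗ (⋯ ⊗ (X (n - 1) ⊗ 𝟙)))`. -/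
def tensorFin : {n : ℕ} → (Fin n → C) → C
  | 0, _ => 𝟙_ C
  | _ + 1, X => X 0 ⊗ tensorFin fun i => X i.succ

/-- The iterated tensor product of morphisms. -/
def tensorFinHom : {n : ℕ} → {X Y : Fin n → C} → (∀ i, X i ⟶ Y i) → (tensorFin X ⟶ tensorFin Y)
  | 0, _, _, _ => 𝟙 (𝟙_ C)
  | _ + 1, _, _, φ => φ 0 ⊗ₘ tensorFinHom fun i => φ i.succ

lemma tensorFinHom_id : ∀ {n : ℕ} (X : Fin n → C), tensorFinHom (fun i => 𝟙 (X i)) = 𝟙 _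
  | 0, _ => rfl
  | n + 1, X => by
    change _ ⊗ₘ _ = 𝟙 (_ ⊗ _)
    rw [tensorFinHom_id (fun i : Fin n => X i.succ), id_tensorHom_id]

lemma tensorFinHom_comp : ∀ {n : ℕ} {X Y Z : Fin n → C} (φ : ∀ i, X i ⟶ Y i) (ψ : ∀ i, Y i ⟶ Z i),
    tensorFinHom (fun i => φ i ≫ ψ i) = tensorFinHom φ ≫ tensorFinHom ψ
  | 0, _, _, _, _, _ => (Category.id_comp _).symm
  | n + 1, _, _, _, φ, ψ => by
    change _ ⊗ₘ _ = (_ ⊗ₘ _) ≫ (_ ⊗ₘ _)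
    rw [tensorFinHom_comp (fun i : Fin n => φ i.succ) (fun i => ψ i.succ), tensorHom_comp_tensorHom]

/-- The cubical functor `I ↦ ⨂ᵢ Zᵢ^I` on the poset of subsets of `[n]`, where `Zᵢ^I` is the codomain
of `f i` if `i ∈ I` and its domain otherwise. -/
def cubical {n : ℕ} (f : Fin n → Arrow C) : Finset (Fin n) ⥤ C where
  obj I := tensorFin fun i => edgeObj (f i) (decide (i ∈ I))
  map {I J} h := tensorFinHom fun i => edgeHom (f i) _ _ (decide_mem_le (leOfHom h) i)
  map_id I := by
    simp only [edgeHom_refl, tensorFinHom_id]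
  map_comp h h' := by
    simp only [← tensorFinHom_comp, edgeHom_comp]

/-- The restriction of the cubical functor to `cat(K)`. -/
abbrev cubicalOn {n : ℕ} (K : NonemptyScpx n) (f : Fin n → Arrow C) : K.Face ⥤ C :=
  (Subtype.mono_coe (· ∈ K.faces)).functor ⋙ cubical f

/-- The cocone on the restricted cubical functor formed by the morphisms induced by the inclusions
`I ⊆ [n]`, with vertex the value at `[n]`. -/
def cubicalCocone {n : ℕ} (K : NonemptyScpx n) (f : Fin n → Arrow C) : Cocone (cubicalOn K f) where
  pt := (cubical f).obj Finset.univ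
  ι :=
    { app I := (cubical f).map (homOfLE (Finset.subset_univ I.1))
      naturality I J h := ((cubical f).map_comp
        ((Subtype.mono_coe (· ∈ K.faces)).functor.map h)
        (homOfLE (Finset.subset_univ J.1))).symm.trans
          (Category.comp_id ((cubical f).map (homOfLE (Finset.subset_univ I.1)))).symm }

/-- The morphism of cubical functors induced by morphisms of arrows. -/
def cubicalMap {n : ℕ} {f g : Fin n → Arrow C} (φ : ∀ i, f i ⟶ g i) : cubical f ⟶ cubical g where
  app _ := tensorFinHom fun i => edgeMap (φ i) _
  naturality I J h := by
    simp only [cubical, ← tensorFinHom_comp, edgeHom_naturality]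

lemma cubicalMap_id_app {n : ℕ} (f : Fin n → Arrow C) (I : Finset (Fin n)) :
    (cubicalMap fun i => 𝟙 (f i)).app I = 𝟙 ((cubical f).obj I) := by
  simp only [cubicalMap, edgeMap_id, tensorFinHom_id]
  rfl

lemma cubicalMap_comp_app {n : ℕ} {f g h : Fin n → Arrow C} (φ : ∀ i, f i ⟶ g i)
    (ψ : ∀ i, g i ⟶ h i) (I : Finset (Fin n)) :
    (cubicalMap fun i => φ i ≫ ψ i).app I = (cubicalMap φ).app I ≫ (cubicalMap ψ).app I := by
  simp only [cubicalMap, edgeMap_comp, tensorFinHom_comp]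
  rfl

variable [∀ (n : ℕ) (K : NonemptyScpx n), HasColimitsOfShape K.Face C]

/-- The composition polyhedral product map of `K` at `f`: the canonical morphism from the colimit of
the cubical functor over `cat(K)` to its value at `[n]`, which is the tensor product of the codomains
of the `f i`. -/
noncomputable abbrev polyMap {n : ℕ} (K : NonemptyScpx n) (f : Fin n → Arrow C) : Arrow C :=
  Arrow.mk (colimit.desc (cubicalOn K f) (cubicalCocone K f))

/-- The morphism between the colimits induced by morphisms of arrows. -/
noncomputable def polyLeft {n : ℕ} (K : NonemptyScpx n) {f g : Fin n → Arrow C}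
    (φ : ∀ i, f i ⟶ g i) : colimit (cubicalOn K f) ⟶ colimit (cubicalOn K g) :=
  colimMap (Functor.whiskerLeft (Subtype.mono_coe (· ∈ K.faces)).functor (cubicalMap φ))

lemma ι_polyLeft {n : ℕ} (K : NonemptyScpx n) {f g : Fin n → Arrow C} (φ : ∀ i, f i ⟶ g i)
    (I : K.Face) : colimit.ι (cubicalOn K f) I ≫ polyLeft K φ =
      (cubicalMap φ).app I.1 ≫ colimit.ι (cubicalOn K g) I :=
  ι_colimMap _ _

/-- The composition polyhedral product map of `K`, as a functor of the arrows `f i`. -/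
noncomputable def polyFunctor {n : ℕ} (K : NonemptyScpx n) : (Fin n → Arrow C) ⥤ Arrow C where
  obj f := polyMap K f
  map {f g} φ := Arrow.homMk (f := polyMap K f) (g := polyMap K g)
    (polyLeft K φ) ((cubicalMap φ).app Finset.univ) (by
      apply colimit.hom_ext
      intro I
      refine (Category.assoc _ (polyLeft K φ) (colimit.desc _ (cubicalCocone K g))).symm.trans ?_
      rw [ι_polyLeft]
      refine (Category.assoc _ _ _).trans ?_
      refine (congrArg _ (colimit.ι_desc (cubicalCocone K g) I)).trans ?_
      refine ((cubicalMap φ).naturality (homOfLE (Finset.subset_univ I.1))).symm.trans ?_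
      refine Eq.trans ?_ (Category.assoc _ (colimit.desc _ (cubicalCocone K f)) _)
      exact congrArg (· ≫ (cubicalMap φ).app Finset.univ)
        (colimit.ι_desc (cubicalCocone K f) I).symm)
  map_id f := Arrow.hom_ext _ _
    (by
      apply colimit.hom_ext
      intro I
      exact (ι_polyLeft K _ I).trans (((cubicalMap_id_app f I.1) ▸ Category.id_comp _).trans
        (Category.comp_id _).symm))
    (cubicalMap_id_app f _)
  map_comp {f g k} φ ψ := Arrow.hom_ext _ _
    (by
      apply colimit.hom_ext
      intro I
      refine (ι_polyLeft K (fun i => φ i ≫ ψ i) I).trans ?_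
      refine Eq.trans ?_ (Category.assoc _ (polyLeft K φ) (polyLeft K ψ))
      rw [ι_polyLeft, cubicalMap_comp_app]
      refine (Category.assoc _ _ _).trans (Eq.trans ?_ (Category.assoc _ _ _).symm)
      exact congrArg _ (ι_polyLeft K ψ I).symm)
    (cubicalMap_comp_app φ ψ _)

/-- `f ↦ (f_{<k}, polyMap L (f_k, ..., f_{k+m-1}), f_{≥k+m})`, as a functor of `f`. -/
noncomputable def insertFunctor {n m : ℕ} (k : Fin n) (L : NonemptyScpx m) :
    (Fin (n + m - 1) → Arrow C) ⥤ (Fin n → Arrow C) :=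
  Functor.pi' fun i =>
    if h : i = k then
      Pi.comap (fun _ : Fin (n + m - 1) => Arrow C) (blockIdx (m := m) k) ⋙ polyFunctor L
    else Pi.eval (fun _ : Fin (n + m - 1) => Arrow C) (outIdx m k i h)

end Polyhedral

/-- The set of arrows of `C`, up to isomorphism of arrows: two arrows are identified if there is a
commutative square between them whose horizontal sides are isomorphisms. -/
abbrev ArrowClass (C : Type u) [Category.{v} C] : Type (max u v) :=
  Quotient (isIsomorphicSetoid (Arrow C))

/-- The isomorphism class of an arrow. -/
abbrev arrowClass {C : Type u} [Category.{v} C] (f : Arrow C) : ArrowClass C :=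
  Quotient.mk (isIsomorphicSetoid (Arrow C)) f

/-- The structural isomorphisms of a braided monoidal category: those generated under composition and
tensor product by identities, associators and unitors, and also by the braiding when `b` holds. If
`C` is strict, then for `b = False` these are identities. -/
inductive IsStructural {C : Type u} [Category.{v} C] [MonoidalCategory C] [BraidedCategory C]
    (b : Prop) : ∀ {X Y : C}, (X ⟶ Y) → Prop
  | id (X : C) : IsStructural b (𝟙 X)
  | comp {X Y Z : C} (f : X ⟶ Y) (g : Y ⟶ Z) :
      IsStructural b f → IsStructural b g → IsStructural b (f ≫ g)
  | tensor {X Y X' Y' : C} (f : X ⟶ Y) (g : X' ⟶ Y') :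
      IsStructural b f → IsStructural b g → IsStructural b (f ⊗ₘ g)
  | associator_hom (X Y Z : C) : IsStructural b (α_ X Y Z).hom
  | associator_inv (X Y Z : C) : IsStructural b (α_ X Y Z).inv
  | leftUnitor_hom (X : C) : IsStructural b (λ_ X).hom
  | leftUnitor_inv (X : C) : IsStructural b (λ_ X).inv
  | rightUnitor_hom (X : C) : IsStructural b (ρ_ X).hom
  | rightUnitor_inv (X : C) : IsStructural b (ρ_ X).inv
  | braiding (h : b) (X Y : C) : IsStructural b (β_ X Y).hom

/-!
The isomorphisms all come from one principle, `exists_polyFunctor_iso`. Suppose that subsets `S` of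
`[N]` and `I` of `[n]` are related by some `R`, with compatible morphisms from the cube of `f` at `S`
to the cube of `H f` at `I` whenever `R S I`. If each face of `M` is related to a smallest face of `K`,
and the cube of `H f` at each face `I` of `K` is the colimit of the cubes of `f` at the `S` related to
`I`, then the cubical functor of `H f` on `cat(K)` is a pointwise left Kan extension of that of `f` on
`cat(M)`, and the colimits over `cat(M)` and `cat(K)` agree.

For the equivariance, `S` is related to `I` if `S ⊆ σ⁻¹ (I)`, and the comparison at `S = σ⁻¹ (I)` is a
permutation of tensor factors.

For the composition, `S` is related to `I` if `I` contains `outerPart k L S`, which consists of the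
part of `S` outside the block at `k` and of `k` itself when the trace of `S` on the block is not a face
of `L`; by `mem_comp_faces_iff`, `S` is a face of `K ∘ᶜ_k L` if and only if `outerPart k L S` is a face
of `K`. The factor `k` of the cube at `I` of the arrows `(f_{<k}, polyMap L (f_k, …), f_{≥k+m})` is the
domain of `polyMap L` if `k ∉ I`, which is a colimit over `cat(L)`, and its codomain if `k ∈ I`, which
is the colimit over all subsets of the block, since `[m]` is the largest one. Because `⊗` preserves
these colimits (`existsUnique_edgeLeg_slot`), the cube at `I` is the colimit of the cubes of `f` at
the subsets formed from `I` outside the block and an admissible `J` on it.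

The structural isomorphisms that regroup or permute the factors of an iterated tensor product are
obtained from lists of objects, where they only need to exist (`StructurallyIso`). Their naturality
follows by applying this existence in the monoidal category of functors `(Fin n → C) ⥤ C` to the
family of evaluation functors (`exists_splitIso`, `exists_splitBlockIso`, `exists_permIso`).
-/

/-! ### Structural isomorphisms -/

section Structural

variable {C : Type u} [Category.{v} C] [MonoidalCategory C] [SymmetricCategory C]

lemma IsStructural.eqToHom (b : Prop) {X Y : C} (h : X = Y) : IsStructural b (eqToHom h) := by
  subst h
  exact IsStructural.id X

lemma IsStructural.tensorFinHom {b : Prop} : ∀ {n : ℕ} {X Y : Fin n → C} (φ : ∀ i, X i ⟶ Y i),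
    (∀ i, IsStructural b (φ i)) → IsStructural b (tensorFinHom φ)
  | 0, _, _, _, _ => IsStructural.id _
  | _ + 1, _, _, φ, h =>
    IsStructural.tensor _ _ (h 0) (IsStructural.tensorFinHom (fun i => φ i.succ) fun i => h i.succ)

/-- Two objects are structurally isomorphic if some isomorphism between them is structural in both
directions. -/
def StructurallyIso (b : Prop) (X Y : C) : Prop :=
  ∃ e : X ≅ Y, IsStructural b e.hom ∧ IsStructural b e.inv

namespace StructurallyIso

variable {b : Prop}

lemma refl (X : C) : StructurallyIso b X X := ⟨Iso.refl X, .id X, .id X⟩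

lemma of_eq {X Y : C} (h : X = Y) : StructurallyIso b X Y := h ▸ refl X

lemma symm {X Y : C} : StructurallyIso b X Y → StructurallyIso b Y X
  | ⟨e, h, h'⟩ => ⟨e.symm, h', h⟩

lemma trans {X Y Z : C} : StructurallyIso b X Y → StructurallyIso b Y Z → StructurallyIso b X Z
  | ⟨e, h, h'⟩, ⟨d, k, k'⟩ => ⟨e ≪≫ d, .comp _ _ h k, .comp _ _ k' h'⟩

lemma tensor {X Y X' Y' : C} :
    StructurallyIso b X Y → StructurallyIso b X' Y' → StructurallyIso b (X ⊗ X') (Y ⊗ Y')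
  | ⟨e, h, h'⟩, ⟨d, k, k'⟩ => ⟨e ⊗ᵢ d, .tensor _ _ h k, .tensor _ _ h' k'⟩

lemma assoc (X Y Z : C) : StructurallyIso b ((X ⊗ Y) ⊗ Z) (X ⊗ (Y ⊗ Z)) :=
  ⟨α_ X Y Z, .associator_hom X Y Z, .associator_inv X Y Z⟩

lemma leftUnitor (X : C) : StructurallyIso b (𝟙_ C ⊗ X) X :=
  ⟨λ_ X, .leftUnitor_hom X, .leftUnitor_inv X⟩

lemma braid (hb : b) (X Y : C) : StructurallyIso b (X ⊗ Y) (Y ⊗ X) :=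
  ⟨β_ X Y, .braiding hb X Y, by
    rw [SymmetricCategory.braiding_swap_eq_inv_braiding X Y |>.symm]
    exact .braiding hb Y X⟩

end StructurallyIso

/-! ### Bracketing and permuting iterated tensor products -/

/-- The iterated tensor product of a list of objects, bracketed to the right like `tensorFin`. -/
def tensorList : List C → C
  | [] => 𝟙_ C
  | X :: l => X ⊗ tensorList l

omit [SymmetricCategory C] in
lemma tensorFin_eq_tensorList : ∀ {n : ℕ} (X : Fin n → C), tensorFin X = tensorList (List.ofFn X)
  | 0, _ => by simp [tensorFin, tensorList]
  | n + 1, X => by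
    rw [List.ofFn_succ]
    exact congrArg (X 0 ⊗ ·) (tensorFin_eq_tensorList fun i => X i.succ)

lemma structurallyIso_tensorList_append (b : Prop) : ∀ l l' : List C,
    StructurallyIso b (tensorList (l ++ l')) (tensorList l ⊗ tensorList l')
  | [], _ => (StructurallyIso.leftUnitor _).symm
  | X :: l, l' => ((StructurallyIso.refl X).tensor (structurallyIso_tensorList_append b l l')).trans
      (StructurallyIso.assoc _ _ _).symm

lemma structurallyIso_tensorList_perm {b : Prop} (hb : b) {l l' : List C} (h : l.Perm l') :
    StructurallyIso b (tensorList l) (tensorList l') := by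
  induction h with
  | nil => exact .refl _
  | cons X _ ih => exact (StructurallyIso.refl X).tensor ih
  | swap X Y l =>
    exact (StructurallyIso.assoc Y X (tensorList l)).symm.trans
      (((StructurallyIso.braid hb Y X).tensor (.refl _)).trans (.assoc X Y _))
  | trans _ _ ih ih' => exact ih.trans ih'

lemma structurallyIso_tensorFin_perm {n : ℕ} (X : Fin n → C) (σ : Equiv.Perm (Fin n)) :
    StructurallyIso True (tensorFin X) (tensorFin fun i => X (σ i)) := by
  rw [tensorFin_eq_tensorList, tensorFin_eq_tensorList]
  exact structurallyIso_tensorList_perm trivial (Equiv.Perm.ofFn_comp_perm σ X).symm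

/-- The `i`-th input below `k`. -/
def lowIdx {n : ℕ} (k : Fin n) (i : Fin k.val) : Fin n := ⟨i.val, i.2.trans k.2⟩

/-- The `i`-th input above `k`. -/
def highIdx {n : ℕ} (k : Fin n) (i : Fin (n - 1 - k.val)) : Fin n :=
  ⟨k.val + 1 + i.val, by have := i.2; omega⟩

lemma lowIdx_ne {n : ℕ} (k : Fin n) (i : Fin k.val) : lowIdx k i ≠ k :=
  Fin.ne_of_val_ne i.2.ne

lemma highIdx_ne {n : ℕ} (k : Fin n) (i : Fin (n - 1 - k.val)) : highIdx k i ≠ k :=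
  Fin.ne_of_val_ne (by simp only [highIdx]; omega)

/-- The factor `k` can be isolated. -/
lemma structurallyIso_tensorFin_split (b : Prop) {n : ℕ} (k : Fin n) (X : Fin n → C) :
    StructurallyIso b (tensorFin X) ((tensorFin fun i => X (lowIdx k i)) ⊗
      (X k ⊗ tensorFin fun i => X (highIdx k i))) := by
  have key : List.ofFn X = (List.ofFn fun i => X (lowIdx k i)) ++
      (X k :: List.ofFn fun i => X (highIdx k i)) := by
    apply List.ext_getElem
    · have := k.2
      simp only [List.length_append, List.length_cons, List.length_ofFn]
      omega
    · intro j h1 h2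
      have := k.2
      simp only [List.getElem_append, List.getElem_cons, List.getElem_ofFn, List.length_ofFn]
      split_ifs with h3 h4
      · rfl
      · exact congrArg X (Fin.ext (by simp only; omega))
      · exact congrArg X (Fin.ext (by simp only [highIdx]; omega))
  rw [tensorFin_eq_tensorList, key]
  refine (structurallyIso_tensorList_append b _ _).trans (.of_eq ?_)
  simp only [tensorFin_eq_tensorList]
  rfl

/-- The factors of a family indexed by the inputs of a composite can be grouped into those before, in
and after the block at `k`. -/
lemma structurallyIso_tensorFin_splitBlock (b : Prop) {n m : ℕ} (k : Fin n)
    (X : Fin (n + m - 1) → C) :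
    StructurallyIso b (tensorFin X)
      ((tensorFin fun i => X (outIdx m k (lowIdx k i) (lowIdx_ne k i))) ⊗
        ((tensorFin fun j => X (blockIdx k j)) ⊗
          tensorFin fun i => X (outIdx m k (highIdx k i) (highIdx_ne k i)))) := by
  have key : List.ofFn X = (List.ofFn fun i => X (outIdx m k (lowIdx k i) (lowIdx_ne k i))) ++
      ((List.ofFn fun j => X (blockIdx k j)) ++
        List.ofFn fun i => X (outIdx m k (highIdx k i) (highIdx_ne k i))) := by
    apply List.ext_getElem
    · have := k.2
      simp only [List.length_append, List.length_ofFn]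
      omega
    · intro j h1 h2
      have := k.2
      simp only [List.getElem_append, List.getElem_ofFn, List.length_ofFn]
      split_ifs with h3 h4
      · exact congrArg X (Fin.ext (by simp [lowIdx, h3]))
      · exact congrArg X (Fin.ext (by simp only [blockIdx_val]; omega))
      · refine congrArg X (Fin.ext ?_)
        simp only [highIdx, outIdx_val]
        rw [if_neg (by omega)]
        omega
  rw [tensorFin_eq_tensorList, key]
  refine (structurallyIso_tensorList_append b _ _).trans ?_
  simp only [tensorFin_eq_tensorList]
  exact (StructurallyIso.refl _).tensor (structurallyIso_tensorList_append b _ _)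

/-- The tensor product of functors is computed objectwise, and so are its structural isomorphisms. -/
lemma IsStructural.app {E : Type*} [Category E] {b : Prop} {F G : E ⥤ C} {f : F ⟶ G}
    (h : IsStructural b f) (x : E) : IsStructural b (f.app x) := by
  induction h with
  | id X => exact .id _
  | comp f g _ _ ihf ihg => exact .comp _ _ ihf ihg
  | tensor f g _ _ ihf ihg => exact .tensor _ _ ihf ihg
  | associator_hom X Y Z => exact .associator_hom _ _ _
  | associator_inv X Y Z => exact .associator_inv _ _ _
  | leftUnitor_hom X => exact .leftUnitor_hom _
  | leftUnitor_inv X => exact .leftUnitor_inv _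
  | rightUnitor_hom X => exact .rightUnitor_hom _
  | rightUnitor_inv X => exact .rightUnitor_inv _
  | braiding hb X Y => exact .braiding hb _ _

/-- Iterated tensor products of functors are computed objectwise. -/
def tensorFinEvalIso {E : Type*} [Category E] :
    {n : ℕ} → (W : Fin n → E ⥤ C) → (x : E) →
      ((tensorFin W).obj x ≅ tensorFin fun i => (W i).obj x)
  | 0, _, _ => Iso.refl (𝟙_ C)
  | _ + 1, W, x => Iso.refl ((W 0).obj x) ⊗ᵢ tensorFinEvalIso (fun i => W i.succ) x

lemma tensorFinEvalIso_structural (b : Prop) {E : Type*} [Category E] :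
    ∀ {n : ℕ} (W : Fin n → E ⥤ C) (x : E), IsStructural b (tensorFinEvalIso W x).hom ∧
      IsStructural b (tensorFinEvalIso W x).inv
  | 0, _, _ => ⟨.id _, .id _⟩
  | _ + 1, W, x =>
    have h := tensorFinEvalIso_structural b (fun i => W i.succ) x
    ⟨.tensor _ _ (.id _) h.1, .tensor _ _ (.id _) h.2⟩

omit [SymmetricCategory C] in
lemma tensorFinEvalIso_naturality {E : Type*} [Category E] :
    ∀ {n : ℕ} (W : Fin n → E ⥤ C) {x y : E} (φ : x ⟶ y),
      (tensorFin W).map φ ≫ (tensorFinEvalIso W y).hom =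
        (tensorFinEvalIso W x).hom ≫ tensorFinHom fun i => (W i).map φ
  | 0, _, _, _, _ => rfl
  | n + 1, W, x, y, φ => by
    change ((W 0).map φ ⊗ₘ (tensorFin fun i => W i.succ).map φ) ≫
      (𝟙 _ ⊗ₘ (tensorFinEvalIso (fun i => W i.succ) y).hom) =
      (𝟙 _ ⊗ₘ (tensorFinEvalIso (fun i => W i.succ) x).hom) ≫
        ((W 0).map φ ⊗ₘ tensorFinHom fun i => (W i.succ).map φ)
    rw [tensorHom_comp_tensorHom, tensorHom_comp_tensorHom, tensorFinEvalIso_naturality,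
      Category.comp_id, Category.id_comp]

end Structural

/-! ### Natural versions of the structural isomorphisms -/

section Splitting

variable {C : Type u} [Category.{v} C] [MonoidalCategory C]

/-- The tensor product of a family, of one object, and of a second family. -/
abbrev slotObj {p q : ℕ} (A : Fin p → C) (Z : C) (B : Fin q → C) : C :=
  tensorFin A ⊗ (Z ⊗ tensorFin B)

/-- The functoriality of `slotObj`. -/
abbrev slotHom {p q : ℕ} {A A' : Fin p → C} {Z Z' : C} {B B' : Fin q → C}
    (a : ∀ i, A i ⟶ A' i) (z : Z ⟶ Z') (b : ∀ i, B i ⟶ B' i) : slotObj A Z B ⟶ slotObj A' Z' B' :=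
  tensorFinHom a ⊗ₘ (z ⊗ₘ tensorFinHom b)

lemma slotHom_comp {p q : ℕ} {A A' A'' : Fin p → C} {Z Z' Z'' : C} {B B' B'' : Fin q → C}
    (a : ∀ i, A i ⟶ A' i) (z : Z ⟶ Z') (b : ∀ i, B i ⟶ B' i)
    (a' : ∀ i, A' i ⟶ A'' i) (z' : Z' ⟶ Z'') (b' : ∀ i, B' i ⟶ B'' i) :
    slotHom a z b ≫ slotHom a' z' b' =
      slotHom (fun i => a i ≫ a' i) (z ≫ z') (fun i => b i ≫ b' i) := by
  rw [slotHom, slotHom, slotHom, tensorHom_comp_tensorHom, tensorHom_comp_tensorHom,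
    tensorFinHom_comp, tensorFinHom_comp]

lemma slotHom_id {p q : ℕ} (A : Fin p → C) (Z : C) (B : Fin q → C) :
    slotHom (fun i => 𝟙 (A i)) (𝟙 Z) (fun i => 𝟙 (B i)) = 𝟙 _ := by
  rw [slotHom, tensorFinHom_id, tensorFinHom_id, id_tensorHom_id, id_tensorHom_id]

variable [SymmetricCategory C]

lemma IsStructural.slotHom {b : Prop} {p q : ℕ} {A A' : Fin p → C} {Z Z' : C} {B B' : Fin q → C}
    {φ : ∀ i, A i ⟶ A' i} {z : Z ⟶ Z'} {ψ : ∀ i, B i ⟶ B' i} (hφ : ∀ i, IsStructural b (φ i))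
    (hz : IsStructural b z) (hψ : ∀ i, IsStructural b (ψ i)) :
    IsStructural b (slotHom φ z ψ) :=
  .tensor _ _ (.tensorFinHom φ hφ) (.tensor _ _ hz (.tensorFinHom ψ hψ))

/-- The tensor product of the evaluation functors at the positions `g i` has value
`⨂ᵢ X (g i)` at `X`. -/
def tensorProjIso {N p : ℕ} (g : Fin p → Fin N) (X : Fin N → C) :
    (tensorFin fun i => Pi.eval (fun _ : Fin N => C) (g i)).obj X ≅ tensorFin fun i => X (g i) :=
  tensorFinEvalIso (fun i => Pi.eval (fun _ : Fin N => C) (g i)) X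

lemma tensorProjIso_structural (b : Prop) {N p : ℕ} (g : Fin p → Fin N) (X : Fin N → C) :
    IsStructural b (tensorProjIso g X).hom ∧ IsStructural b (tensorProjIso g X).inv :=
  tensorFinEvalIso_structural b _ X

omit [SymmetricCategory C] in
lemma tensorProjIso_naturality {N p : ℕ} (g : Fin p → Fin N) {X Y : Fin N → C}
    (φ : ∀ i, X i ⟶ Y i) :
    (tensorFin fun i => Pi.eval (fun _ : Fin N => C) (g i)).map φ ≫ (tensorProjIso g Y).hom =
      (tensorProjIso g X).hom ≫ tensorFinHom fun i => φ (g i) :=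
  tensorFinEvalIso_naturality (fun i => Pi.eval (fun _ : Fin N => C) (g i)) φ

omit [SymmetricCategory C] in
lemma tensorFinHom_comp_tensorProjIso_inv {N : ℕ} {X Y : Fin N → C} (φ : ∀ i, X i ⟶ Y i) :
    tensorFinHom φ ≫ (tensorProjIso id Y).inv =
      (tensorProjIso id X).inv ≫ (tensorFin fun i => Pi.eval (fun _ : Fin N => C) i).map φ := by
  rw [Iso.comp_inv_eq, Category.assoc, Iso.eq_inv_comp]
  exact (tensorProjIso_naturality id φ).symm

/-- The associators and unitors that isolate the factor `k`, naturally. Naturality comes for free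
from the existence of the isomorphism in the category of functors `(Fin n → C) ⥤ C`, for the family
of evaluation functors. -/
lemma exists_splitIso {n : ℕ} (k : Fin n) :
    ∃ e : ∀ X : Fin n → C, tensorFin X ≅
        slotObj (fun i => X (lowIdx k i)) (X k) (fun i => X (highIdx k i)),
      (∀ X, IsStructural False (e X).hom ∧ IsStructural False (e X).inv) ∧
      ∀ (X Y : Fin n → C) (φ : ∀ i, X i ⟶ Y i), tensorFinHom φ ≫ (e Y).hom = (e X).hom ≫
        slotHom (fun i => φ (lowIdx k i)) (φ k) (fun i => φ (highIdx k i)) := by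
  obtain ⟨e, he, he'⟩ := structurallyIso_tensorFin_split False k
    fun i => Pi.eval (fun _ : Fin n => C) i
  refine ⟨fun X => (tensorProjIso id X).symm ≪≫ e.app X ≪≫ (tensorProjIso (lowIdx k) X ⊗ᵢ
    (Iso.refl _ ⊗ᵢ tensorProjIso (highIdx k) X)), fun X => ⟨?_, ?_⟩, fun X Y φ => ?_⟩
  · exact .comp _ _ (tensorProjIso_structural _ _ X).2 (.comp _ _ (he.app X)
      (.tensor _ _ (tensorProjIso_structural _ _ X).1
        (.tensor _ _ (.id _) (tensorProjIso_structural _ _ X).1)))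
  · exact .comp _ _ (.comp _ _ (.tensor _ _ (tensorProjIso_structural _ _ X).2
        (.tensor _ _ (.id _) (tensorProjIso_structural _ _ X).2)) (he'.app X))
          (tensorProjIso_structural _ _ X).1
  · have hnat := e.hom.naturality φ
    simp only [Iso.trans_hom, Iso.symm_hom, Category.assoc]
    rw [reassoc_of% (tensorFinHom_comp_tensorProjIso_inv φ)]
    refine congrArg (_ ≫ ·) (((reassoc_of% hnat) _).trans
      (Eq.trans (congrArg (e.hom.app X ≫ ·) ?_) (Category.assoc _ _ _).symm))
    change (_ ⊗ₘ (φ k ⊗ₘ _)) ≫ (_ ⊗ₘ (𝟙 _ ⊗ₘ _)) = (_ ⊗ₘ (𝟙 _ ⊗ₘ _)) ≫ (_ ⊗ₘ (φ k ⊗ₘ _))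
    simp only [tensorHom_comp_tensorHom, Category.comp_id, Category.id_comp]
    rw [tensorProjIso_naturality, tensorProjIso_naturality]

/-- The associators and unitors that group the factors of the block at `k`, naturally. -/
lemma exists_splitBlockIso {n : ℕ} (m : ℕ) (k : Fin n) :
    ∃ e : ∀ X : Fin (n + m - 1) → C, tensorFin X ≅
        slotObj (fun i => X (outIdx m k (lowIdx k i) (lowIdx_ne k i)))
          (tensorFin fun j => X (blockIdx k j))
          (fun i => X (outIdx m k (highIdx k i) (highIdx_ne k i))),
      (∀ X, IsStructural False (e X).hom ∧ IsStructural False (e X).inv) ∧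
      ∀ (X Y : Fin (n + m - 1) → C) (φ : ∀ i, X i ⟶ Y i),
        tensorFinHom φ ≫ (e Y).hom = (e X).hom ≫
          slotHom (fun i => φ (outIdx m k (lowIdx k i) (lowIdx_ne k i)))
            (tensorFinHom fun j => φ (blockIdx k j))
            (fun i => φ (outIdx m k (highIdx k i) (highIdx_ne k i))) := by
  obtain ⟨e, he, he'⟩ := structurallyIso_tensorFin_splitBlock False k
    fun i => Pi.eval (fun _ : Fin (n + m - 1) => C) i
  refine ⟨fun X => (tensorProjIso id X).symm ≪≫ e.app X ≪≫
    (tensorProjIso (fun i => outIdx m k (lowIdx k i) (lowIdx_ne k i)) X ⊗ᵢ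
      (tensorProjIso (blockIdx k) X ⊗ᵢ
        tensorProjIso (fun i => outIdx m k (highIdx k i) (highIdx_ne k i)) X)),
    fun X => ⟨?_, ?_⟩, fun X Y φ => ?_⟩
  · exact .comp _ _ (tensorProjIso_structural _ _ X).2 (.comp _ _ (he.app X)
      (.tensor _ _ (tensorProjIso_structural _ _ X).1
        (.tensor _ _ (tensorProjIso_structural _ _ X).1 (tensorProjIso_structural _ _ X).1)))
  · exact .comp _ _ (.comp _ _ (.tensor _ _ (tensorProjIso_structural _ _ X).2
        (.tensor _ _ (tensorProjIso_structural _ _ X).2 (tensorProjIso_structural _ _ X).2))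
          (he'.app X)) (tensorProjIso_structural _ _ X).1
  · have hnat := e.hom.naturality φ
    simp only [Iso.trans_hom, Iso.symm_hom, Category.assoc]
    rw [reassoc_of% (tensorFinHom_comp_tensorProjIso_inv φ)]
    refine congrArg (_ ≫ ·) (((reassoc_of% hnat) _).trans
      (Eq.trans (congrArg (e.hom.app X ≫ ·) ?_) (Category.assoc _ _ _).symm))
    change (_ ⊗ₘ (_ ⊗ₘ _)) ≫ (_ ⊗ₘ (_ ⊗ₘ _)) = (_ ⊗ₘ (_ ⊗ₘ _)) ≫ (_ ⊗ₘ (_ ⊗ₘ _))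
    simp only [tensorHom_comp_tensorHom]
    rw [tensorProjIso_naturality, tensorProjIso_naturality, tensorProjIso_naturality]

/-- The structural isomorphisms that permute the factors, naturally. -/
lemma exists_permIso {n : ℕ} (σ : Equiv.Perm (Fin n)) :
    ∃ e : ∀ X : Fin n → C, tensorFin X ≅ tensorFin fun i => X (σ i),
      (∀ X, IsStructural True (e X).hom) ∧
      ∀ (X Y : Fin n → C) (φ : ∀ i, X i ⟶ Y i),
        tensorFinHom φ ≫ (e Y).hom = (e X).hom ≫ tensorFinHom fun i => φ (σ i) := by
  obtain ⟨e, he, -⟩ := structurallyIso_tensorFin_perm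
    (fun i => Pi.eval (fun _ : Fin n => C) i) σ
  refine ⟨fun X => (tensorProjIso id X).symm ≪≫ e.app X ≪≫ tensorProjIso σ X,
    fun X => ?_, fun X Y φ => ?_⟩
  · exact .comp _ _ (tensorProjIso_structural _ _ X).2 (.comp _ _ (he.app X)
      (tensorProjIso_structural _ _ X).1)
  · have hnat := e.hom.naturality φ
    simp only [Iso.trans_hom, Iso.symm_hom, Category.assoc]
    rw [reassoc_of% (tensorFinHom_comp_tensorProjIso_inv φ)]
    exact congrArg (_ ≫ ·) (((reassoc_of% hnat) _).trans
      (congrArg (e.hom.app X ≫ ·) (tensorProjIso_naturality σ φ)))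

end Splitting

/-! ### Values of the cubical functor -/

section Edge

lemma decide_le_decide {p q : Prop} [Decidable p] [Decidable q] (h : p → q) :
    decide p ≤ decide q := by
  by_cases hp : p
  · simp [hp, h hp]
  · simp [hp]

variable {C : Type u} [Category.{v} C]

lemma isIso_edgeHom (f : Arrow C) {a b : Bool} (h : a ≤ b) (h' : b ≤ a) :
    IsIso (edgeHom f a b h) :=
  ⟨edgeHom f b a h', by rw [edgeHom_comp, edgeHom_refl], by rw [edgeHom_comp, edgeHom_refl]⟩

variable [MonoidalCategory C]

lemma isIso_tensorFinHom {n : ℕ} {X Y : Fin n → C} (φ : ∀ i, X i ⟶ Y i) (h : ∀ i, IsIso (φ i)) :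
    IsIso (tensorFinHom φ) :=
  ⟨tensorFinHom fun i => inv (φ i), by simp [← tensorFinHom_comp, tensorFinHom_id],
    by simp [← tensorFinHom_comp, tensorFinHom_id]⟩

/-- The value at `S` of the cubical functor. -/
abbrev cube {n : ℕ} (f : Fin n → Arrow C) (S : Finset (Fin n)) : C :=
  tensorFin fun i => edgeObj (f i) (decide (i ∈ S))

/-- The value at `S ⊆ S'` of the cubical functor. -/
abbrev cubeMap {n : ℕ} (f : Fin n → Arrow C) {S S' : Finset (Fin n)} (h : S ≤ S') :
    cube f S ⟶ cube f S' :=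
  tensorFinHom fun i => edgeHom (f i) _ _ (decide_mem_le h i)

/-- The functoriality of `cube` in the arrows. -/
abbrev cubeNat {n : ℕ} {f g : Fin n → Arrow C} (φ : ∀ i, f i ⟶ g i) (S : Finset (Fin n)) :
    cube f S ⟶ cube g S :=
  tensorFinHom fun i => edgeMap (φ i) _

variable [SymmetricCategory C]

lemma IsStructural.edgeHom (p : Prop) (f : Arrow C) {a b : Bool} (h : a ≤ b) (h' : b ≤ a) :
    IsStructural p (edgeHom f a b h) := by
  obtain rfl := le_antisymm h h'
  rw [edgeHom_refl]
  exact .id _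

end Edge

/-! ### Comparing colimits of cubical functors -/

section Comparison

variable {C : Type u} [Category.{v} C] [MonoidalCategory C]
  [∀ (n : ℕ) (K : NonemptyScpx n), HasColimitsOfShape K.Face C]

/-- The coprojection of the face `S` into the colimit of the cubical functor over `cat(K)`. -/
noncomputable def polyι {n : ℕ} (K : NonemptyScpx n) (f : Fin n → Arrow C) (S : Finset (Fin n))
    (hS : S ∈ K.faces) : cube f S ⟶ colimit (cubicalOn K f) :=
  colimit.ι (cubicalOn K f) ⟨S, hS⟩

/-- The underlying morphism of `polyMap K f`. -/
noncomputable def polyHom {n : ℕ} (K : NonemptyScpx n) (f : Fin n → Arrow C) :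
    colimit (cubicalOn K f) ⟶ cube f Finset.univ :=
  colimit.desc (cubicalOn K f) (cubicalCocone K f)

section

variable {n : ℕ} (K : NonemptyScpx n) (f : Fin n → Arrow C)

lemma map_polyι {S S' : Finset (Fin n)} (h : S' ≤ S) (hS : S ∈ K.faces) :
    cubeMap f h ≫ polyι K f S hS = polyι K f S' (K.faces.lower h hS) :=
  colimit.w (cubicalOn K f) (homOfLE (show (⟨S', K.faces.lower h hS⟩ : K.Face) ≤ ⟨S, hS⟩ from h))

lemma polyι_polyHom (S : Finset (Fin n)) (hS : S ∈ K.faces) :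
    polyι K f S hS ≫ polyHom K f = cubeMap f (Finset.subset_univ S) :=
  colimit.ι_desc (cubicalCocone K f) ⟨S, hS⟩

lemma polyι_polyLeft {f g : Fin n → Arrow C} (φ : ∀ i, f i ⟶ g i) (S : Finset (Fin n))
    (hS : S ∈ K.faces) :
    polyι K f S hS ≫ polyLeft K φ = cubeNat φ S ≫ polyι K g S hS :=
  ι_polyLeft K φ ⟨S, hS⟩

variable {K f} in
lemma poly_hom_ext {T : C} {d d' : colimit (cubicalOn K f) ⟶ T}
    (h : ∀ S hS, polyι K f S hS ≫ d = polyι K f S hS ≫ d') : d = d' :=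
  colimit.hom_ext fun S => h S.1 S.2

lemma exists_polyDesc {T : C} (g : ∀ S ∈ K.faces, cube f S ⟶ T)
    (hg : ∀ S S' (h : S' ≤ S) (hS : S ∈ K.faces),
      cubeMap f h ≫ g S hS = g S' (K.faces.lower h hS)) :
    ∃ d : colimit (cubicalOn K f) ⟶ T, ∀ S hS, polyι K f S hS ≫ d = g S hS :=
  ⟨colimit.desc (cubicalOn K f)
    { pt := T
      ι :=
        { app S := g S.1 S.2
          naturality S S' h :=
            (hg S'.1 S.1 (leOfHom h) S'.2).trans (Category.comp_id (g S.1 S.2)).symm } },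
    fun S hS => colimit.ι_desc _ (⟨S, hS⟩ : K.Face)⟩

end

variable [SymmetricCategory C]

/-- A criterion for `polyFunctor M` and `H ⋙ polyFunctor K` to be isomorphic.

It starts from a relation `R` between subsets of `[N]` and of `[n]`, and from a compatible family of
morphisms `θ S I` of values of the cubical functors, for `R S I`. Every face `S` of `M` is related to a
smallest face of `K`, which gives a morphism from the colimit over `cat(M)` to that over `cat(K)`.
By `hcol`, the value at a face `I` of `K` is the colimit of the values at the `S` with `R S I`, so
the cubical functor on `cat(K)` is a pointwise left Kan extension of the one on `cat(M)`; hence the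
colimits agree. On codomains the isomorphism is `θ` at the full subsets. -/
theorem exists_polyFunctor_iso {N n : ℕ} (b : Prop) (M : NonemptyScpx N) (K : NonemptyScpx n)
    (H : (Fin N → Arrow C) ⥤ (Fin n → Arrow C))
    (R : Finset (Fin N) → Finset (Fin n) → Prop)
    (hR : ∀ {S S' I I'}, S' ≤ S → I ≤ I' → R S I → R S' I')
    (θ : ∀ f S I, R S I → (cube f S ⟶ cube (H.obj f) I))
    (map_θ : ∀ f {S S' I} (hS : S' ≤ S) (h : R S I),
      cubeMap f hS ≫ θ f S I h = θ f S' I (hR hS le_rfl h))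
    (θ_map : ∀ f {S I I'} (hI : I ≤ I') (h : R S I),
      θ f S I h ≫ cubeMap (H.obj f) hI = θ f S I' (hR le_rfl hI h))
    (θ_naturality : ∀ {f g} (φ : f ⟶ g) S I (h : R S I),
      cubeNat φ S ≫ θ g S I h = θ f S I h ≫ cubeNat (H.map φ) I)
    (hmin : ∀ S ∈ M.faces, ∃ I ∈ K.faces, R S I ∧ ∀ I', R S I' → I ≤ I')
    (hM : ∀ I ∈ K.faces, ∀ S, R S I → S ∈ M.faces)
    (hcol : ∀ f, ∀ I ∈ K.faces, ∀ (T : C) (g : ∀ S, R S I → (cube f S ⟶ T)),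
      (∀ S S' (hS : S' ≤ S) (h : R S I),
        cubeMap f hS ≫ g S h = g S' (hR hS le_rfl h)) →
      ∃! d : cube (H.obj f) I ⟶ T, ∀ S h, θ f S I h ≫ d = g S h)
    (huniv : R Finset.univ Finset.univ) (hiso : ∀ f, IsIso (θ f _ _ huniv))
    (hst : ∀ f, IsStructural b (θ f _ _ huniv)) :
    ∃ e : polyFunctor M ≅ H ⋙ polyFunctor K, ∀ f, IsStructural b (e.hom.app f).right := by
  choose r hrK hrR hrmin using hmin
  -- the leg at `S` may be computed at any face `I` of `K` related to `S`
  have hleg (f : Fin N → Arrow C) (S hS I hI) (h : R S I) :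
      θ f S I h ≫ polyι K (H.obj f) I hI =
        θ f S (r S hS) (hrR S hS) ≫ polyι K (H.obj f) (r S hS) (hrK S hS) := by
    rw [← θ_map f (hrmin S hS I h) (hrR S hS), Category.assoc, map_polyι]
  have hfwd (f : Fin N → Arrow C) := exists_polyDesc M f
    (fun S hS => θ f S (r S hS) (hrR S hS) ≫ polyι K (H.obj f) (r S hS) (hrK S hS))
    (fun S S' h hS => by
      rw [← Category.assoc, map_θ, hleg])
  choose fwd ι_fwd using hfwd
  have ι_fwd' (f : Fin N → Arrow C) (S hS I hI) (h : R S I) :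
      polyι M f S hS ≫ fwd f = θ f S I h ≫ polyι K (H.obj f) I hI := by
    rw [ι_fwd, hleg f S hS I hI h]
  have hback (f : Fin N → Arrow C) (I : Finset (Fin n)) (hI : I ∈ K.faces) :=
    hcol f I hI (colimit (cubicalOn M f)) (fun S h => polyι M f S (hM I hI S h))
      (fun S S' hS h => map_polyι M f hS _)
  choose d hd hd' using hback
  have hbwd (f : Fin N → Arrow C) := exists_polyDesc K (H.obj f) (d f)
    (fun I I' h hI => hd' f I' _ _ (fun S hS => by
      rw [← Category.assoc, θ_map f h hS]
      exact hd f I hI S _))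
  choose bwd ι_bwd using hbwd
  have fwd_bwd (f : Fin N → Arrow C) : fwd f ≫ bwd f = 𝟙 _ := poly_hom_ext fun S hS => by
    rw [← Category.assoc, ι_fwd, Category.assoc, ι_bwd, Category.comp_id]
    exact hd f _ _ _ _
  have bwd_fwd (f : Fin N → Arrow C) : bwd f ≫ fwd f = 𝟙 _ := poly_hom_ext fun I hI => by
    rw [← Category.assoc, ι_bwd, Category.comp_id]
    refine (hcol f I hI _ (fun S h => θ f S I h ≫ polyι K (H.obj f) I hI)
      (fun S S' hS h => by rw [← Category.assoc, map_θ])).unique (fun S h => ?_) fun _ _ => rfl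
    rw [← Category.assoc]
    exact (congrArg (· ≫ fwd f) (hd f I hI S h)).trans (ι_fwd' f S _ I hI h)
  have hsq (f : Fin N → Arrow C) :
      fwd f ≫ polyHom K (H.obj f) = polyHom M f ≫ θ f _ _ huniv := poly_hom_ext fun S hS => by
    rw [← Category.assoc, ι_fwd, Category.assoc, polyι_polyHom, ← Category.assoc, polyι_polyHom,
      θ_map f, map_θ f]
  have hnat {f g : Fin N → Arrow C} (φ : f ⟶ g) :
      polyLeft M φ ≫ fwd g = fwd f ≫ polyLeft K (H.map φ) := poly_hom_ext fun S hS => by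
    rw [← Category.assoc, polyι_polyLeft, Category.assoc, ι_fwd, ← Category.assoc, θ_naturality,
      Category.assoc, ← Category.assoc (polyι M f S hS), ι_fwd, Category.assoc, polyι_polyLeft]
  exact ⟨NatIso.ofComponents
    (fun f => Arrow.isoMk (f := polyMap M f) (g := polyMap K (H.obj f))
      ⟨fwd f, bwd f, fwd_bwd f, bwd_fwd f⟩ (@asIso _ _ _ _ (θ f _ _ huniv) (hiso f)) (hsq f))
    (fun {f g} φ => Arrow.hom_ext _ _ (hnat φ) (θ_naturality φ _ _ huniv)), hst⟩

end Comparison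

/-! ### Unit and equivariance -/

section UnitEquivariance

variable {C : Type u} [Category.{v} C] [MonoidalCategory C] [SymmetricCategory C]
  [∀ (n : ℕ) (K : NonemptyScpx n), HasColimitsOfShape K.Face C]

/-- The only face of `{∅}` is `∅`, where the cubical functor has value `Y ⊗ 𝟙`; the isomorphism is
a right unitor on both ends. -/
theorem exists_polyFunctor_unit_iso :
    ∃ e : polyFunctor NonemptyScpx.unit ≅ Pi.eval (fun _ : Fin 1 => Arrow C) 0,
      ∀ f, IsStructural False (e.hom.app f).right := by
  have hS (S : Finset (Fin 1)) (hS : S ∈ NonemptyScpx.unit.faces) : decide (0 ∈ S) ≤ false := by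
    have : S ≤ ∅ := hS
    simp [Finset.subset_empty.1 this]
  have h0 : (∅ : Finset (Fin 1)) ∈ NonemptyScpx.unit.faces := NonemptyScpx.empty_mem _
  let r (f : Fin 1 → Arrow C) (S : Finset (Fin 1)) :
      cube f S ≅ edgeObj (f 0) (decide (0 ∈ S)) := ρ_ _
  have hr (f : Fin 1 → Arrow C) {S S' : Finset (Fin 1)} (h : S ≤ S') :
      cubeMap f h ≫ (r f S').hom =
        (r f S).hom ≫ edgeHom (f 0) _ _ (decide_mem_le h 0) := by
    change (_ ⊗ₘ 𝟙 (𝟙_ C)) ≫ _ = _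
    rw [tensorHom_id]
    exact rightUnitor_naturality _
  have hr' {f g : Fin 1 → Arrow C} (φ : ∀ i, f i ⟶ g i) (S : Finset (Fin 1)) :
      cubeNat φ S ≫ (r g S).hom = (r f S).hom ≫ edgeMap (φ 0) (decide (0 ∈ S)) := by
    change (_ ⊗ₘ 𝟙 (𝟙_ C)) ≫ _ = _
    rw [tensorHom_id]
    exact rightUnitor_naturality _
  have hfwd (f : Fin 1 → Arrow C) := exists_polyDesc NonemptyScpx.unit f (T := edgeObj (f 0) false)
    (fun S h => (r f S).hom ≫ edgeHom (f 0) _ _ (hS S h))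
    (fun S S' h h' => by rw [← Category.assoc, hr f h, Category.assoc, edgeHom_comp])
  choose fwd ι_fwd using hfwd
  let bwd (f : Fin 1 → Arrow C) : edgeObj (f 0) false ⟶ colimit (cubicalOn NonemptyScpx.unit f) :=
    edgeHom (f 0) _ _ (Bool.false_le _) ≫ (r f ∅).inv ≫ polyι _ f ∅ h0
  have fwd_bwd (f : Fin 1 → Arrow C) : fwd f ≫ bwd f = 𝟙 _ := poly_hom_ext fun S h => by
    obtain rfl : S = ∅ := Finset.subset_empty.1 h
    rw [← Category.assoc, ι_fwd, Category.assoc, ← Category.assoc (edgeHom _ _ _ _), edgeHom_comp,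
      edgeHom_refl, Category.id_comp, Iso.hom_inv_id_assoc, Category.comp_id]
  have bwd_fwd (f : Fin 1 → Arrow C) : bwd f ≫ fwd f = 𝟙 _ := by
    rw [Category.assoc, Category.assoc, ι_fwd, Iso.inv_hom_id_assoc, edgeHom_comp, edgeHom_refl]
  have htop : decide (0 ∈ (Finset.univ : Finset (Fin 1))) ≤ true := Bool.le_true _
  have htop' : true ≤ decide (0 ∈ (Finset.univ : Finset (Fin 1))) := by simp
  let right (f : Fin 1 → Arrow C) : cube f Finset.univ ≅ edgeObj (f 0) true :=
    r f _ ≪≫ @asIso _ _ _ _ (edgeHom (f 0) _ _ htop) (isIso_edgeHom (f 0) htop htop')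
  have hsq (f : Fin 1 → Arrow C) : fwd f ≫ edgeHom (f 0) false true (Bool.false_le _) = polyHom _ f ≫ (right f).hom :=
    poly_hom_ext fun S h => by
      rw [← Category.assoc, ι_fwd, ← Category.assoc, polyι_polyHom, Category.assoc]
      rw [edgeHom_comp]
      change _ = _ ≫ (r f _).hom ≫ edgeHom (f 0) _ _ htop
      rw [← Category.assoc, hr, Category.assoc, edgeHom_comp]
  have hnat {f g : Fin 1 → Arrow C} (φ : ∀ i, f i ⟶ g i) :
      polyLeft _ φ ≫ fwd g = fwd f ≫ edgeMap (φ 0) false := poly_hom_ext fun S h => by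
    rw [← Category.assoc, polyι_polyLeft, Category.assoc, ι_fwd, ← Category.assoc, hr',
      ← Category.assoc (polyι _ f S h), ι_fwd, Category.assoc, Category.assoc, edgeHom_naturality]
  have hnat' {f g : Fin 1 → Arrow C} (φ : ∀ i, f i ⟶ g i) :
      cubeNat φ _ ≫ (right g).hom = (right f).hom ≫ edgeMap (φ 0) true := by
    change _ ≫ (r g _).hom ≫ edgeHom (g 0) _ _ htop =
      ((r f _).hom ≫ edgeHom (f 0) _ _ htop) ≫ _
    rw [← Category.assoc, hr', Category.assoc, Category.assoc, edgeHom_naturality]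
  exact ⟨NatIso.ofComponents
    (fun f => Arrow.isoMk (f := polyMap _ f) (g := f 0)
      ⟨fwd f, bwd f, fwd_bwd f, bwd_fwd f⟩ (right f) (hsq f))
    (fun {f g} φ => Arrow.hom_ext _ _ (hnat φ) (hnat' φ)),
    fun f => .comp _ _ (.rightUnitor_hom _) (.edgeHom _ _ htop htop')⟩

/-- Here the comparison morphisms `θ S I` come from the permutation of the factors, and `θ S I` is
invertible for the face `S = σ⁻¹ (I)`, which is the largest one related to `I`. -/
theorem exists_polyFunctor_act_iso {n : ℕ} (K : NonemptyScpx n) (σ : Equiv.Perm (Fin n)) :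
    ∃ e : polyFunctor (K.act σ) ≅
        Pi.comap (fun _ : Fin n => Arrow C) (σ⁻¹ : Equiv.Perm (Fin n)) ⋙ polyFunctor K,
      ∀ f, IsStructural True (e.hom.app f).right := by
  obtain ⟨e, he, e_naturality⟩ := exists_permIso (C := C) σ⁻¹
  let R (S I : Finset (Fin n)) : Prop := ∀ i, σ⁻¹ i ∈ S → i ∈ I
  have hR {S S' I I' : Finset (Fin n)} (hS : S' ≤ S) (hI : I ≤ I') (h : R S I) : R S' I' :=
    fun i hi => hI (h i (hS hi))
  let θ (f : Fin n → Arrow C) (S I : Finset (Fin n)) (h : R S I) :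
      cube f S ⟶ cube (fun i => f (σ⁻¹ i)) I :=
    (e _).hom ≫ tensorFinHom fun i => edgeHom (f (σ⁻¹ i)) _ _ (decide_le_decide (h i))
  have hθ (f : Fin n → Arrow C) (S I : Finset (Fin n)) (h : R S I) (h' : ∀ i ∈ I, σ⁻¹ i ∈ S) :
      IsIso (θ f S I h) := by
    have := isIso_tensorFinHom
      (fun i => edgeHom (f (σ⁻¹ i)) _ _ (decide_le_decide (h i)))
      fun i => isIso_edgeHom _ _ (decide_le_decide (h' i))
    exact IsIso.comp_isIso
  have map_θ (f : Fin n → Arrow C) {S S' I : Finset (Fin n)} (hS : S' ≤ S) (h : R S I) :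
      cubeMap f hS ≫ θ f S I h = θ f S' I (hR hS le_rfl h) := by
    simp only [θ, cubeMap]
    rw [← Category.assoc, e_naturality, Category.assoc, ← tensorFinHom_comp]
    simp only [edgeHom_comp]
  have θ_map (f : Fin n → Arrow C) {S I I' : Finset (Fin n)} (hI : I ≤ I') (h : R S I) :
      θ f S I h ≫ cubeMap _ hI = θ f S I' (hR le_rfl hI h) := by
    simp only [θ, cubeMap]
    rw [Category.assoc, ← tensorFinHom_comp]
    simp only [edgeHom_comp]
  have θ_naturality {f g : Fin n → Arrow C} (φ : ∀ i, f i ⟶ g i) (S I : Finset (Fin n))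
      (h : R S I) : cubeNat φ S ≫ θ g S I h = θ f S I h ≫ cubeNat (fun i => φ (σ⁻¹ i)) I := by
    simp only [θ, cubeNat]
    rw [← Category.assoc, e_naturality, Category.assoc, Category.assoc, ← tensorFinHom_comp,
      ← tensorFinHom_comp]
    simp only [edgeHom_naturality]
  -- the face of `K · σ` corresponding to `I`
  let p (I : Finset (Fin n)) : Finset (Fin n) := I.map (σ⁻¹).toEmbedding
  have hp (I : Finset (Fin n)) (i : Fin n) : σ⁻¹ i ∈ p I ↔ i ∈ I :=
    Finset.mem_map' (σ⁻¹).toEmbedding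
  have hRp {S I : Finset (Fin n)} (h : R S I) : S ≤ p I := fun x hx => by
    obtain ⟨i, rfl⟩ := (σ⁻¹ : Equiv.Perm (Fin n)).surjective x
    exact (hp I i).2 (h i hx)
  have huniv : R Finset.univ Finset.univ := fun _ _ => Finset.mem_univ _
  refine exists_polyFunctor_iso True (K.act σ) K
    (Pi.comap (fun _ : Fin n => Arrow C) (σ⁻¹ : Equiv.Perm (Fin n))) R hR θ map_θ θ_map
    θ_naturality ?_ ?_ ?_ huniv (fun f => hθ f _ _ huniv fun _ _ => Finset.mem_univ _) ?_
  · rintro _ ⟨I, hI, rfl⟩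
    exact ⟨I, hI, fun i => (hp I i).1, fun I' h i hi => h i ((hp I i).2 hi)⟩
  · intro I hI S h
    exact (K.act σ).faces.lower (hRp h) ⟨I, hI, rfl⟩
  · intro f I hI T g hg
    have hpI : R (p I) I := fun i => (hp I i).1
    have := hθ f (p I) I hpI fun i => (hp I i).2
    refine ⟨inv (θ f (p I) I hpI) ≫ g (p I) hpI, fun S h => ?_, fun d hd => ?_⟩
    · rw [← map_θ f (hRp h) hpI, Category.assoc, IsIso.hom_inv_id_assoc, hg]
    · exact (IsIso.eq_inv_comp _).2 (hd _ hpI)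
  · intro f
    exact .comp _ _ (he _) (.tensorFinHom _ fun i => .edgeHom _ _
      (decide_le_decide (huniv i)) (decide_le_decide fun _ => Finset.mem_univ _))

end UnitEquivariance

/-! ### The ends of a polyhedral product map as colimits -/

section Leg

variable {C : Type u} [Category.{v} C] [MonoidalCategory C]

lemma cubeMap_refl {n : ℕ} (f : Fin n → Arrow C) {S : Finset (Fin n)} (h : S ≤ S) :
    cubeMap f h = 𝟙 _ := by
  simp only [cubeMap, edgeHom_refl, tensorFinHom_id]

lemma cubeMap_comp {n : ℕ} (f : Fin n → Arrow C) {S S' S'' : Finset (Fin n)} (h : S ≤ S')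
    (h' : S' ≤ S'') : cubeMap f h ≫ cubeMap f h' = cubeMap f (h.trans h') := by
  simp only [cubeMap, ← tensorFinHom_comp, edgeHom_comp]

lemma cubeNat_cubeMap {n : ℕ} {f g : Fin n → Arrow C} (φ : ∀ i, f i ⟶ g i)
    {S S' : Finset (Fin n)} (h : S ≤ S') :
    cubeNat φ S ≫ cubeMap g h = cubeMap f h ≫ cubeNat φ S' := by
  simp only [cubeMap, cubeNat, ← tensorFinHom_comp, edgeHom_naturality]

variable [∀ (n : ℕ) (K : NonemptyScpx n), HasColimitsOfShape K.Face C]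

/-- The canonical morphism from the value at `J` of the cubical functor to an end of `polyMap L g`:
the coprojection into the colimit if this end is the domain, in which case `J` must be a face of `L`,
and the value at `J ⊆ [m]` of the cubical functor if it is the codomain. -/
noncomputable def edgeLeg {m : ℕ} (L : NonemptyScpx m) (g : Fin m → Arrow C) (J : Finset (Fin m)) :
    ∀ a : Bool, a = true ∨ J ∈ L.faces → (cube g J ⟶ edgeObj (polyMap L g) a)
  | false, h => polyι L g J (h.resolve_left Bool.false_ne_true)
  | true, _ => cubeMap g (Finset.subset_univ J)

variable {m : ℕ} (L : NonemptyScpx m)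

/-- The morphism between the arrows `polyMap L f` and `polyMap L g` given by functoriality. -/
noncomputable def polyMapHom {f g : Fin m → Arrow C} (φ : ∀ j, f j ⟶ g j) :
    polyMap L f ⟶ polyMap L g :=
  (polyFunctor L).map φ

lemma cubeMap_edgeLeg (g : Fin m → Arrow C) {J J' : Finset (Fin m)} (hJ : J' ≤ J) (a : Bool)
    (h : a = true ∨ J ∈ L.faces) :
    cubeMap g hJ ≫ edgeLeg L g J a h = edgeLeg L g J' a (h.imp_right (L.faces.lower hJ)) := by
  cases a
  · exact map_polyι L g hJ _
  · exact cubeMap_comp g hJ (Finset.subset_univ J)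

lemma edgeLeg_edgeHom (g : Fin m → Arrow C) {J : Finset (Fin m)} {a a' : Bool} (ha : a ≤ a')
    (h : a = true ∨ J ∈ L.faces) (h' : a' = true ∨ J ∈ L.faces) :
    edgeLeg L g J a h ≫ edgeHom (polyMap L g) a a' ha = edgeLeg L g J a' h' := by
  cases a <;> cases a'
  · exact Category.comp_id _
  · exact polyι_polyHom L g J _
  · exact absurd ha (by decide)
  · exact Category.comp_id _

lemma edgeLeg_naturality {f g : Fin m → Arrow C} (φ : ∀ j, f j ⟶ g j) (J : Finset (Fin m))
    (a : Bool) (h : a = true ∨ J ∈ L.faces) :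
    cubeNat φ J ≫ edgeLeg L g J a h =
      edgeLeg L f J a h ≫ edgeMap (polyMapHom L φ) a := by
  cases a
  · exact (polyι_polyLeft L φ J _).symm
  · exact cubeNat_cubeMap φ (Finset.subset_univ J)

lemma edgeLeg_univ (g : Fin m → Arrow C) :
    edgeLeg L g Finset.univ true (Or.inl rfl) = 𝟙 (cube g Finset.univ) :=
  cubeMap_refl g le_rfl

lemma edgeLeg_univ_isIso (g : Fin m → Arrow C) {a : Bool} (ha : a = true)
    (h : a = true ∨ Finset.univ ∈ L.faces) : IsIso (edgeLeg L g Finset.univ a h) := by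
  subst ha
  rw [edgeLeg_univ]
  exact inferInstanceAs (IsIso (𝟙 (cube g Finset.univ)))

lemma edgeLeg_univ_structural [SymmetricCategory C] (b : Prop) (g : Fin m → Arrow C) {a : Bool}
    (ha : a = true) (h : a = true ∨ Finset.univ ∈ L.faces) :
    IsStructural b (edgeLeg L g Finset.univ a h) := by
  subst ha
  rw [edgeLeg_univ]
  exact IsStructural.id (cube g Finset.univ)

/-- Both ends of `polyMap L g` are colimits of values of the cubical functor of `g`, over `cat(L)` for
the domain and over all subsets, which have a largest element, for the codomain. These colimits are
preserved by tensoring with objects on both sides. -/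
lemma existsUnique_edgeLeg_slot
    [∀ (n : ℕ) (K : NonemptyScpx n) (X : C), PreservesColimitsOfShape K.Face (tensorLeft X)]
    [∀ (n : ℕ) (K : NonemptyScpx n) (X : C), PreservesColimitsOfShape K.Face (tensorRight X)]
    (g : Fin m → Arrow C) (a : Bool) {p q : ℕ} (A : Fin p → C) (B : Fin q → C) {T : C}
    (t : ∀ J, (a = true ∨ J ∈ L.faces) → (slotObj A (cube g J) B ⟶ T))
    (ht : ∀ J J' (hJ : J' ≤ J) (h : a = true ∨ J ∈ L.faces),
      slotHom (fun i => 𝟙 (A i)) (cubeMap g hJ) (fun i => 𝟙 (B i)) ≫ t J h =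
        t J' (h.imp_right (L.faces.lower hJ))) :
    ∃! d : slotObj A (edgeObj (polyMap L g) a) B ⟶ T,
      ∀ J h, slotHom (fun i => 𝟙 (A i)) (edgeLeg L g J a h) (fun i => 𝟙 (B i)) ≫ d = t J h := by
  cases a
  · let F : C ⥤ C := tensorRight (tensorFin B) ⋙ tensorLeft (tensorFin A)
    have hF {Z Z' : C} (z : Z ⟶ Z') :
        slotHom (fun i => 𝟙 (A i)) z (fun i => 𝟙 (B i)) = F.map z := by
      simp [slotHom, tensorFinHom_id, F]
    let c : Cocone (cubicalOn L g) := colimit.cocone _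
    have hc : IsColimit (F.mapCocone c) := isColimitOfPreserves F (colimit.isColimit _)
    let s : Cocone (cubicalOn L g ⋙ F) :=
      { pt := T
        ι :=
          { app J := t J.1 (Or.inr J.2)
            naturality J J' h := by
              refine Eq.trans ?_ (Category.comp_id _).symm
              refine Eq.trans ?_ (ht J'.1 J.1 (leOfHom h) (Or.inr J'.2))
              exact congrArg (· ≫ t J'.1 (Or.inr J'.2)) (hF _).symm } }
    refine ⟨hc.desc s, fun J h => ?_, fun d hd => hc.hom_ext fun J => ?_⟩
    · refine Eq.trans (congrArg (· ≫ hc.desc s) (hF _)) ?_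
      exact hc.fac s ⟨J, h.resolve_left Bool.false_ne_true⟩
    · refine Eq.trans ?_ (hc.fac s J).symm
      exact Eq.trans (congrArg (· ≫ d) (hF _)).symm (hd J.1 (Or.inr J.2))
  · refine ⟨t Finset.univ (Or.inl rfl), fun J h => ht _ _ (Finset.subset_univ J) _, fun d hd => ?_⟩
    refine Eq.trans ?_ (hd Finset.univ (Or.inl rfl))
    rw [edgeLeg_univ]
    exact (Category.id_comp d).symm.trans (congrArg (· ≫ d) (slotHom_id A _ B).symm)

end Leg

/-! ### Faces of a composite complex -/

section Support

/-- The trace on the block at `k` of a subset of the inputs of a composite. -/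
def blockPart {n m : ℕ} (k : Fin n) (S : Finset (Fin (n + m - 1))) : Finset (Fin m) :=
  Finset.univ.filter fun j => blockIdx k j ∈ S

@[simp] lemma mem_blockPart {n m : ℕ} {k : Fin n} {S : Finset (Fin (n + m - 1))} {j : Fin m} :
    j ∈ blockPart k S ↔ blockIdx k j ∈ S := by simp [blockPart]

/-- The inputs `i ≠ k` that lie in `S`, together with `k` if the trace of `S` on the block is not a
face of `L`. This is the smallest `I` such that `S ⊆ I ∘ᶜ_k J` for some face `J` of `L`. -/
noncomputable def outerPart {n m : ℕ} (k : Fin n) (L : NonemptyScpx m)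
    (S : Finset (Fin (n + m - 1))) : Finset (Fin n) :=
  open Classical in Finset.univ.filter fun i =>
    if h : i = k then blockPart k S ∉ L.faces else outIdx m k i h ∈ S

lemma outerPart_le_iff {n m : ℕ} {k : Fin n} {L : NonemptyScpx m} {S : Finset (Fin (n + m - 1))}
    {I : Finset (Fin n)} : outerPart k L S ≤ I ↔
      (∀ i (h : i ≠ k), outIdx m k i h ∈ S → i ∈ I) ∧ (k ∈ I ∨ blockPart k S ∈ L.faces) := by
  constructor
  · intro H
    refine ⟨fun i h hi => H (by simp [outerPart, h, hi]), ?_⟩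
    by_contra! hk
    exact hk.1 (H (by simp [outerPart, hk.2]))
  · rintro ⟨h1, h2⟩ i hi
    by_cases hik : i = k
    · subst hik
      simp only [outerPart, Finset.mem_filter, dite_true] at hi
      exact h2.resolve_right hi.2
    · simp only [outerPart, Finset.mem_filter, hik, dite_false] at hi
      exact h1 i hik hi.2

lemma mem_comp_faces_iff {n m : ℕ} {k : Fin n} {K : NonemptyScpx n} {L : NonemptyScpx m}
    {S : Finset (Fin (n + m - 1))} :
    S ∈ (NonemptyScpx.comp k K L).faces ↔ outerPart k L S ∈ K.faces := by
  constructor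
  · rintro ⟨I, hI, J, hJ, h⟩
    refine K.faces.lower (outerPart_le_iff.2 ⟨fun i hi hS => ?_, ?_⟩) hI
    · exact (outIdx_mem_subsetComp k I J i hi).1 (h hS)
    · refine or_iff_not_imp_left.2 fun hk => L.faces.lower (fun j hj => ?_) hJ
      exact ((blockIdx_mem_subsetComp k I J j).1 (h (mem_blockPart.1 hj))).resolve_left hk
  · intro hS
    obtain ⟨h1, h2⟩ := outerPart_le_iff.1 (le_refl (outerPart k L S))
    have (x) (hx : x ∈ S) (J : Finset (Fin m)) (hJ : k ∈ outerPart k L S ∨ blockPart k S ≤ J) :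
        x ∈ subsetComp k (outerPart k L S) J := by
      rcases exists_idx k x with ⟨j, rfl⟩ | ⟨i, hi, rfl⟩
      · rw [blockIdx_mem_subsetComp]
        exact hJ.imp_right fun h => h (mem_blockPart.2 hx)
      · rw [outIdx_mem_subsetComp]
        exact h1 i hi hx
    rcases h2 with h2 | h2
    · exact ⟨_, hS, ∅, L.empty_mem, fun x hx => this x hx _ (Or.inl h2)⟩
    · exact ⟨_, hS, _, h2, fun x hx => this x hx _ (Or.inr le_rfl)⟩

lemma outerPart_mono {n m : ℕ} (k : Fin n) (L : NonemptyScpx m) {S S' : Finset (Fin (n + m - 1))}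
    (h : S' ≤ S) : outerPart k L S' ≤ outerPart k L S := by
  obtain ⟨h1, h2⟩ := outerPart_le_iff.1 (le_refl (outerPart k L S))
  refine outerPart_le_iff.2 ⟨fun i hi hS => h1 i hi (h hS), h2.imp_right (L.faces.lower ?_)⟩
  exact fun j hj => mem_blockPart.2 (h (mem_blockPart.1 hj))

/-- The subset of the inputs of a composite with part `I` outside the block at `k` and trace `J` on
the block. -/
def glue {n m : ℕ} (k : Fin n) (I : Finset (Fin n)) (J : Finset (Fin m)) :
    Finset (Fin (n + m - 1)) :=
  subsetComp k (I.erase k) J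

lemma blockIdx_mem_glue {n m : ℕ} {k : Fin n} {I : Finset (Fin n)} {J : Finset (Fin m)}
    {j : Fin m} : blockIdx k j ∈ glue k I J ↔ j ∈ J := by
  simp [glue, blockIdx_mem_subsetComp]

lemma outIdx_mem_glue {n m : ℕ} {k : Fin n} {I : Finset (Fin n)} {J : Finset (Fin m)}
    {i : Fin n} (h : i ≠ k) : outIdx m k i h ∈ glue k I J ↔ i ∈ I := by
  simp [glue, outIdx_mem_subsetComp, h]

lemma blockPart_glue {n m : ℕ} (k : Fin n) (I : Finset (Fin n)) (J : Finset (Fin m)) :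
    blockPart k (glue k I J) = J := by
  ext j
  simp [blockIdx_mem_glue]

lemma le_glue {n m : ℕ} {k : Fin n} {I : Finset (Fin n)} {J : Finset (Fin m)}
    {S : Finset (Fin (n + m - 1))} (h : ∀ i (h : i ≠ k), outIdx m k i h ∈ S → i ∈ I)
    (h' : blockPart k S ≤ J) : S ≤ glue k I J := by
  intro x hx
  rcases exists_idx k x with ⟨j, rfl⟩ | ⟨i, hi, rfl⟩
  · exact blockIdx_mem_glue.2 (h' (mem_blockPart.2 hx))
  · exact (outIdx_mem_glue hi).2 (h i hi hx)

end Support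

/-! ### Splitting off the block at an input, and the inserted arrows -/

section Insert

variable {C : Type u} [Category.{v} C] [MonoidalCategory C] [SymmetricCategory C]

omit [MonoidalCategory C] [SymmetricCategory C] in
lemma isIso_edgeMap {f g : Arrow C} (φ : f ⟶ g) [IsIso φ] (a : Bool) : IsIso (edgeMap φ a) :=
  ⟨edgeMap (inv φ) a, by rw [← edgeMap_comp, IsIso.hom_inv_id, edgeMap_id],
    by rw [← edgeMap_comp, IsIso.inv_hom_id, edgeMap_id]⟩

omit [SymmetricCategory C] in
lemma isIso_slotHom {p q : ℕ} {A A' : Fin p → C} {Z Z' : C} {B B' : Fin q → C}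
    (φ : ∀ i, A i ⟶ A' i) (z : Z ⟶ Z') (ψ : ∀ i, B i ⟶ B' i) (hφ : ∀ i, IsIso (φ i))
    (hz : IsIso z) (hψ : ∀ i, IsIso (ψ i)) : IsIso (slotHom φ z ψ) := by
  have := isIso_tensorFinHom φ hφ
  have := isIso_tensorFinHom ψ hψ
  exact inferInstance

/-- A chosen natural structural isomorphism that isolates the factor `k`. -/
noncomputable def splitIso {n : ℕ} (k : Fin n) (X : Fin n → C) :
    tensorFin X ≅ slotObj (fun i => X (lowIdx k i)) (X k) (fun i => X (highIdx k i)) :=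
  (exists_splitIso k).choose X

lemma splitIso_structural {n : ℕ} (k : Fin n) (X : Fin n → C) :
    IsStructural False (splitIso k X).hom ∧ IsStructural False (splitIso k X).inv :=
  (exists_splitIso k).choose_spec.1 X

lemma splitIso_inv_naturality {n : ℕ} (k : Fin n) {X Y : Fin n → C} (φ : ∀ i, X i ⟶ Y i) :
    (splitIso k X).inv ≫ tensorFinHom φ =
      slotHom (fun i => φ (lowIdx k i)) (φ k) (fun i => φ (highIdx k i)) ≫ (splitIso k Y).inv := by
  rw [Iso.inv_comp_eq, ← Category.assoc, Iso.eq_comp_inv]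
  exact (exists_splitIso k).choose_spec.2 X Y φ

/-- The position in the composite of the `i`-th input of the outer operation below `k`. -/
abbrev outLow {n : ℕ} (m : ℕ) (k : Fin n) (i : Fin k.val) : Fin (n + m - 1) :=
  outIdx m k (lowIdx k i) (lowIdx_ne k i)

/-- The position in the composite of the `i`-th input of the outer operation above `k`. -/
abbrev outHigh {n : ℕ} (m : ℕ) (k : Fin n) (i : Fin (n - 1 - k.val)) : Fin (n + m - 1) :=
  outIdx m k (highIdx k i) (highIdx_ne k i)

/-- A chosen natural structural isomorphism that groups the factors of the block at `k`. -/
noncomputable def splitBlockIso {n m : ℕ} (k : Fin n) (X : Fin (n + m - 1) → C) :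
    tensorFin X ≅ slotObj (fun i => X (outLow m k i)) (tensorFin fun j => X (blockIdx k j))
      (fun i => X (outHigh m k i)) :=
  (exists_splitBlockIso m k).choose X

lemma splitBlockIso_structural {n m : ℕ} (k : Fin n) (X : Fin (n + m - 1) → C) :
    IsStructural False (splitBlockIso k X).hom ∧ IsStructural False (splitBlockIso k X).inv :=
  (exists_splitBlockIso m k).choose_spec.1 X

lemma splitBlockIso_hom_naturality {n m : ℕ} (k : Fin n) {X Y : Fin (n + m - 1) → C}
    (φ : ∀ i, X i ⟶ Y i) :
    tensorFinHom φ ≫ (splitBlockIso k Y).hom = (splitBlockIso k X).hom ≫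
      slotHom (fun i => φ (outLow m k i)) (tensorFinHom fun j => φ (blockIdx k j))
        (fun i => φ (outHigh m k i)) :=
  (exists_splitBlockIso m k).choose_spec.2 X Y φ

lemma splitBlockIso_inv_naturality {n m : ℕ} (k : Fin n) {X Y : Fin (n + m - 1) → C}
    (φ : ∀ i, X i ⟶ Y i) :
    (splitBlockIso k X).inv ≫ tensorFinHom φ =
      slotHom (fun i => φ (outLow m k i)) (tensorFinHom fun j => φ (blockIdx k j))
        (fun i => φ (outHigh m k i)) ≫ (splitBlockIso k Y).inv := by
  rw [Iso.inv_comp_eq, ← Category.assoc, Iso.eq_comp_inv]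
  exact splitBlockIso_hom_naturality k φ

/-- `insertFunctor` is defined by cases, so its components are identified by equalities of functors. -/
lemma IsStructural.eqToHom_app_right {E : Type*} [Category E] {D : Type*} [Category D]
    {F G : E ⥤ Arrow C} (b : Prop) (h : F = G) (f : E) :
    IsStructural b ((CategoryTheory.eqToHom h).app f).right := by
  subst h
  exact .id _

variable [∀ (n : ℕ) (K : NonemptyScpx n), HasColimitsOfShape K.Face C]

/-- The family of morphisms of arrows underlying the action of `insertFunctor` on morphisms. -/
noncomputable def insertMap {n m : ℕ} (k : Fin n) (L : NonemptyScpx m)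
    {f g : Fin (n + m - 1) → Arrow C} (φ : ∀ i, f i ⟶ g i) (i : Fin n) :
    (insertFunctor k L).obj f i ⟶ (insertFunctor k L).obj g i :=
  (insertFunctor k L ⋙ Pi.eval _ i).map φ

lemma exists_insertFunctor_iso_self {n m : ℕ} (k : Fin n) (L : NonemptyScpx m) :
    ∃ κ : ∀ f : Fin (n + m - 1) → Arrow C,
        polyMap L (fun j => f (blockIdx k j)) ≅ (insertFunctor k L).obj f k,
      (∀ f, IsStructural False (κ f).hom.right) ∧
      ∀ f g (φ : ∀ i, f i ⟶ g i), polyMapHom L (fun j => φ (blockIdx k j)) ≫ (κ g).hom =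
        (κ f).hom ≫ insertMap k L (f := f) (g := g) φ k := by
  have h : Pi.comap (fun _ : Fin (n + m - 1) => Arrow C) (blockIdx (m := m) k) ⋙ polyFunctor L =
      insertFunctor (C := C) k L ⋙ Pi.eval _ k := by
    rw [insertFunctor, Functor.pi'_eval, dif_pos rfl]
  exact ⟨fun f => (eqToIso h).app f, fun f => IsStructural.eqToHom_app_right (D := C) False h f,
    fun _ _ φ => (eqToHom h).naturality φ⟩

lemma exists_insertFunctor_iso {n m : ℕ} (k : Fin n) (L : NonemptyScpx m) (i : Fin n)
    (hi : i ≠ k) :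
    ∃ ω : ∀ f : Fin (n + m - 1) → Arrow C, f (outIdx m k i hi) ≅ (insertFunctor k L).obj f i,
      (∀ f, IsStructural False (ω f).hom.right) ∧
      ∀ f g (φ : ∀ i, f i ⟶ g i), φ (outIdx m k i hi) ≫ (ω g).hom =
        (ω f).hom ≫ insertMap k L (f := f) (g := g) φ i := by
  have h : Pi.eval (fun _ : Fin (n + m - 1) => Arrow C) (outIdx m k i hi) =
      insertFunctor (C := C) k L ⋙ Pi.eval _ i := by
    rw [insertFunctor, Functor.pi'_eval, dif_neg hi]
  exact ⟨fun f => (eqToIso h).app f, fun f => IsStructural.eqToHom_app_right (D := C) False h f,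
    fun _ _ φ => (eqToHom h).naturality φ⟩

end Insert

/-! ### Moving between a cube and a cube with a distinguished slot -/

section Slot

variable {C : Type u} [Category.{v} C] [MonoidalCategory C]

/-- The tensor product of an object `Z`, placed at `k`, and of the values at `I` of the arrows at the
outer inputs `≠ k` of a composite. -/
abbrev slotCube {n m : ℕ} (k : Fin n) (f : Fin (n + m - 1) → Arrow C) (I : Finset (Fin n)) (Z : C) :
    C :=
  slotObj (fun i => edgeObj (f (outLow m k i)) (decide (lowIdx k i ∈ I))) Z
    (fun i => edgeObj (f (outHigh m k i)) (decide (highIdx k i ∈ I)))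

/-- The functoriality of `slotCube` in the subset and the object. -/
abbrev slotCubeMap {n m : ℕ} (k : Fin n) (f : Fin (n + m - 1) → Arrow C) {I I' : Finset (Fin n)}
    (h : I ≤ I') {Z Z' : C} (z : Z ⟶ Z') : slotCube k f I Z ⟶ slotCube k f I' Z' :=
  slotHom (fun _ => edgeHom _ _ _ (decide_mem_le h _)) z
    (fun _ => edgeHom _ _ _ (decide_mem_le h _))

/-- The functoriality of `slotCube` in the arrows and the object. -/
abbrev slotCubeNat {n m : ℕ} (k : Fin n) {f g : Fin (n + m - 1) → Arrow C} (φ : ∀ i, f i ⟶ g i)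
    (I : Finset (Fin n)) {Z Z' : C} (z : Z ⟶ Z') : slotCube k f I Z ⟶ slotCube k g I Z' :=
  slotHom (fun _ => edgeMap (φ _) _) z (fun _ => edgeMap (φ _) _)

variable {n m : ℕ} (k : Fin n) (f : Fin (n + m - 1) → Arrow C)

lemma slotCubeMap_comp {I I' I'' : Finset (Fin n)} (h : I ≤ I') (h' : I' ≤ I'') {Z Z' Z'' : C}
    (z : Z ⟶ Z') (z' : Z' ⟶ Z'') :
    slotCubeMap k f h z ≫ slotCubeMap k f h' z' = slotCubeMap k f (h.trans h') (z ≫ z') := by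
  simp only [slotHom_comp, edgeHom_comp]

lemma slotCubeNat_slotCubeMap {f g : Fin (n + m - 1) → Arrow C} (φ : ∀ i, f i ⟶ g i)
    {I I' : Finset (Fin n)} (h : I ≤ I') {Z W Z' W' : C} {z : Z ⟶ Z'} {w : W ⟶ W'} {a : Z ⟶ W}
    {a' : Z' ⟶ W'} (hz : a ≫ w = z ≫ a') :
    slotCubeNat k φ I a ≫ slotCubeMap k g h w = slotCubeMap k f h z ≫ slotCubeNat k φ I' a' := by
  simp only [slotHom_comp, edgeHom_naturality, hz]

lemma slotCubeMap_refl (I : Finset (Fin n)) {Z Z' : C} (z : Z ⟶ Z') :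
    slotCubeMap k f (le_refl I) z = slotHom (fun _ => 𝟙 _) z (fun _ => 𝟙 _) := by
  simp only [slotCubeMap, edgeHom_refl]

lemma slotCubeMap_id (I : Finset (Fin n)) (Z : C) :
    slotCubeMap k f (le_refl I) (𝟙 Z) = 𝟙 _ := by
  rw [slotCubeMap_refl, slotHom_id]

variable [SymmetricCategory C]

/-- The parts of `S` outside the block at `k` and on the block are contained in `I` and `J`. -/
def PartsLE (S : Finset (Fin (n + m - 1))) (I : Finset (Fin n)) (J : Finset (Fin m)) : Prop :=
  (∀ i (h : i ≠ k), outIdx m k i h ∈ S → i ∈ I) ∧ ∀ j, blockIdx k j ∈ S → j ∈ J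

/-- The parts of `S` outside the block at `k` and on the block contain `I` and `J`. -/
def LEParts (S : Finset (Fin (n + m - 1))) (I : Finset (Fin n)) (J : Finset (Fin m)) : Prop :=
  (∀ i (h : i ≠ k), i ∈ I → outIdx m k i h ∈ S) ∧ ∀ j ∈ J, blockIdx k j ∈ S

variable {k}

/-- The map that groups the factors of the block and enlarges the subsets. -/
noncomputable def regroup {S : Finset (Fin (n + m - 1))} {I : Finset (Fin n)} {J : Finset (Fin m)}
    (h : PartsLE k S I J) : cube f S ⟶ slotCube k f I (cube (fun j => f (blockIdx k j)) J) :=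
  (splitBlockIso k fun i => edgeObj (f i) (decide (i ∈ S))).hom ≫ slotHom
    (fun i => edgeHom _ _ _ (decide_le_decide (h.1 (lowIdx k i) (lowIdx_ne k i))))
    (tensorFinHom fun j => edgeHom _ _ _ (decide_le_decide (h.2 j)))
    (fun i => edgeHom _ _ _ (decide_le_decide (h.1 (highIdx k i) (highIdx_ne k i))))

/-- The map that enlarges the subsets and ungroups the factors of the block. -/
noncomputable def ungroup {S : Finset (Fin (n + m - 1))} {I : Finset (Fin n)} {J : Finset (Fin m)}
    (h : LEParts k S I J) : slotCube k f I (cube (fun j => f (blockIdx k j)) J) ⟶ cube f S :=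
  slotHom
    (fun i => edgeHom _ _ _ (decide_le_decide (h.1 (lowIdx k i) (lowIdx_ne k i))))
    (tensorFinHom fun j => edgeHom _ _ _ (decide_le_decide (h.2 j)))
    (fun i => edgeHom _ _ _ (decide_le_decide (h.1 (highIdx k i) (highIdx_ne k i)))) ≫
  (splitBlockIso k fun i => edgeObj (f i) (decide (i ∈ S))).inv

variable {S S' : Finset (Fin (n + m - 1))} {I I' : Finset (Fin n)} {J J' : Finset (Fin m)}

lemma cubeMap_regroup (hS : S' ≤ S) (h : PartsLE k S I J) (h' : PartsLE k S' I J) :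
    cubeMap f hS ≫ regroup f h = regroup f h' := by
  simp only [cubeMap, regroup]
  rw [← Category.assoc, splitBlockIso_hom_naturality, Category.assoc, slotHom_comp,
    ← tensorFinHom_comp]
  simp only [edgeHom_comp]

lemma regroup_slotCubeMap (hI : I ≤ I') (hJ : J ≤ J') (h : PartsLE k S I J)
    (h' : PartsLE k S I' J') :
    regroup f h ≫ slotCubeMap k f hI (cubeMap _ hJ) = regroup f h' := by
  simp only [cubeMap, regroup]
  rw [Category.assoc, slotHom_comp, ← tensorFinHom_comp]
  simp only [edgeHom_comp]

lemma regroup_ungroup (hS : S ≤ S') (h : PartsLE k S I J) (h' : LEParts k S' I J) :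
    regroup f h ≫ ungroup f h' = cubeMap f hS := by
  simp only [cubeMap, regroup, ungroup]
  rw [Category.assoc, ← Category.assoc (slotHom _ _ _), slotHom_comp, ← Category.assoc,
    Iso.comp_inv_eq, splitBlockIso_hom_naturality, ← tensorFinHom_comp]
  simp only [edgeHom_comp]

lemma ungroup_regroup (hI : I ≤ I') (hJ : J ≤ J') (h : LEParts k S I J) (h' : PartsLE k S I' J') :
    ungroup f h ≫ regroup f h' = slotCubeMap k f hI (cubeMap _ hJ) := by
  simp only [cubeMap, regroup, ungroup]
  rw [Category.assoc, Iso.inv_hom_id_assoc, slotHom_comp, ← tensorFinHom_comp]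
  simp only [edgeHom_comp]

lemma slotCubeMap_ungroup (hI : I' ≤ I) (hJ : J' ≤ J) (h : LEParts k S I J)
    (h' : LEParts k S I' J') :
    slotCubeMap k f hI (cubeMap _ hJ) ≫ ungroup f h = ungroup f h' := by
  simp only [cubeMap, ungroup]
  rw [← Category.assoc, slotHom_comp, ← tensorFinHom_comp]
  simp only [edgeHom_comp]

lemma ungroup_cubeMap (hS : S ≤ S') (h : LEParts k S I J) (h' : LEParts k S' I J) :
    ungroup f h ≫ cubeMap f hS = ungroup f h' := by
  simp only [cubeMap, ungroup]
  rw [Category.assoc, splitBlockIso_inv_naturality, ← Category.assoc, slotHom_comp,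
    ← tensorFinHom_comp]
  simp only [edgeHom_comp]

variable {f} in
lemma regroup_naturality {g : Fin (n + m - 1) → Arrow C} (φ : ∀ i, f i ⟶ g i)
    (h : PartsLE k S I J) : cubeNat φ S ≫ regroup g h =
      regroup f h ≫ slotCubeNat k φ I (cubeNat (fun j => φ (blockIdx k j)) J) := by
  simp only [cubeNat, regroup]
  rw [← Category.assoc, splitBlockIso_hom_naturality, Category.assoc, Category.assoc, slotHom_comp,
    slotHom_comp, ← tensorFinHom_comp, ← tensorFinHom_comp]
  simp only [edgeHom_naturality]

lemma isIso_regroup (h : PartsLE k S I J) (h' : LEParts k S I J) : IsIso (regroup f h) :=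
  ⟨ungroup f h', by rw [regroup_ungroup f le_rfl, cubeMap_refl],
    by rw [ungroup_regroup f le_rfl le_rfl, cubeMap_refl, slotCubeMap_id]⟩

lemma regroup_structural (h : PartsLE k S I J) (h' : LEParts k S I J) :
    IsStructural False (regroup f h) :=
  .comp _ _ (splitBlockIso_structural k _).1 (.slotHom
    (fun i => .edgeHom _ _ _ (decide_le_decide (h'.1 _ (lowIdx_ne k i))))
    (.tensorFinHom _ fun j => .edgeHom _ _ _ (decide_le_decide (h'.2 j)))
    (fun i => .edgeHom _ _ _ (decide_le_decide (h'.1 _ (highIdx_ne k i)))))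

end Slot

/-! ### Composition -/

section Composition

variable {C : Type u} [Category.{v} C] [MonoidalCategory C] [SymmetricCategory C]
  [∀ (n : ℕ) (K : NonemptyScpx n), HasColimitsOfShape K.Face C]

/-- The cube of the arrows `(f_{<k}, polyMap L (f_k, …), f_{≥k+m})` at `I` is `slotCube` with an end of
`polyMap L` in the slot, naturally in `I` and `f`. -/
theorem exists_insertCube {n m : ℕ} (k : Fin n) (L : NonemptyScpx m) :
    ∃ o : ∀ (f : Fin (n + m - 1) → Arrow C) (I : Finset (Fin n)),
        slotCube k f I (edgeObj (polyMap L fun j => f (blockIdx k j)) (decide (k ∈ I))) ≅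
          cube ((insertFunctor k L).obj f) I,
      (∀ f {I I'} (hI : I ≤ I'), (o f I).hom ≫ cubeMap _ hI =
        slotCubeMap k f hI (edgeHom _ _ _ (decide_mem_le hI k)) ≫ (o f I').hom) ∧
      (∀ f g (φ : ∀ i, f i ⟶ g i) I, (o f I).hom ≫
        cubeNat (f := (insertFunctor k L).obj f) (g := (insertFunctor k L).obj g) (insertMap k L (f := f) (g := g) φ) I =
        slotCubeNat k (f := f) (g := g) φ I (edgeMap (polyMapHom L (f := fun j => f (blockIdx k j))
          (g := fun j => g (blockIdx k j)) fun j => φ (blockIdx k j)) _) ≫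
          (o g I).hom) ∧
      ∀ f, IsStructural False (o f Finset.univ).hom := by
  obtain ⟨κ, κ_structural, κ_naturality⟩ := exists_insertFunctor_iso_self (C := C) k L
  choose ω ω_structural ω_naturality using exists_insertFunctor_iso (C := C) k L
  have hedge {f g : Arrow C} (φ : f ⟶ g) (h : IsStructural False φ.right) {a : Bool}
      (ha : a = true) : IsStructural False (edgeMap φ a) := by
    subst ha
    exact h
  let z (f : Fin (n + m - 1) → Arrow C) (I : Finset (Fin n)) := slotHom
    (fun i => edgeMap (ω _ (lowIdx_ne k i) f).hom (decide (lowIdx k i ∈ I)))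
    (edgeMap (κ f).hom (decide (k ∈ I)))
    (fun i => edgeMap (ω _ (highIdx_ne k i) f).hom (decide (highIdx k i ∈ I)))
  have hz (f : Fin (n + m - 1) → Arrow C) (I : Finset (Fin n)) : IsIso (z f I) :=
    isIso_slotHom _ _ _ (fun _ => isIso_edgeMap _ _) (isIso_edgeMap _ _)
      fun _ => isIso_edgeMap _ _
  refine ⟨fun f I => asIso (z f I) ≪≫
    (splitIso k fun i => edgeObj ((insertFunctor k L).obj f i) (decide (i ∈ I))).symm, ?_, ?_, ?_⟩
  · intro f I I' hI
    simp only [z, Iso.trans_hom, asIso_hom, Iso.symm_hom, Category.assoc]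
    rw [splitIso_inv_naturality, ← Category.assoc, ← Category.assoc, slotHom_comp, slotHom_comp]
    simp only [edgeHom_naturality]
  · intro f g φ I
    simp only [z, Iso.trans_hom, asIso_hom, Iso.symm_hom, Category.assoc]
    rw [splitIso_inv_naturality, ← Category.assoc, ← Category.assoc, slotHom_comp, slotHom_comp]
    simp only [← edgeMap_comp, κ_naturality, ω_naturality]
  · intro f
    exact .comp _ _ (.slotHom (fun i => hedge _ (ω_structural _ _ f) (by simp))
      (hedge _ (κ_structural f) (by simp)) (fun i => hedge _ (ω_structural _ _ f) (by simp)))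
      (splitIso_structural k _).2

variable
  [∀ (n : ℕ) (K : NonemptyScpx n) (X : C), PreservesColimitsOfShape K.Face (tensorLeft X)]
  [∀ (n : ℕ) (K : NonemptyScpx n) (X : C), PreservesColimitsOfShape K.Face (tensorRight X)]

/-- Here `S` is related to `I` if `outerPart k L S ⊆ I`. The value at such an `I` is, up to structural
isomorphisms, a tensor product with an end of `polyMap L` in the slot `k`. As this end is a colimit
over the admissible subsets `J` of the block, the value at `I` is the colimit of the values at the
subsets `glue k I J`, and these are cofinal among the `S` related to `I`. -/
theorem exists_polyFunctor_comp_iso {n m : ℕ} (k : Fin n) (K : NonemptyScpx n)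
    (L : NonemptyScpx m) :
    ∃ e : polyFunctor (C := C) (NonemptyScpx.comp k K L) ≅ insertFunctor k L ⋙ polyFunctor K,
      ∀ f, IsStructural False (e.hom.app f).right := by
  obtain ⟨o, o_cubeMap, o_naturality, o_structural⟩ := exists_insertCube (C := C) k L
  let R (S : Finset (Fin (n + m - 1))) (I : Finset (Fin n)) : Prop := outerPart k L S ≤ I
  have hR {S S' I I'} (hS : S' ≤ S) (hI : I ≤ I') (h : R S I) : R S' I' :=
    (outerPart_mono k L hS).trans (h.trans hI)
  have hparts {S I} (h : R S I) : PartsLE k S I (blockPart k S) :=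
    ⟨(outerPart_le_iff.1 h).1, fun _ => mem_blockPart.2⟩
  have hface {S I} (h : R S I) : decide (k ∈ I) = true ∨ blockPart k S ∈ L.faces :=
    (outerPart_le_iff.1 h).2.imp_left fun h => decide_eq_true h
  have hR' {S I} {J : Finset (Fin m)} (h : PartsLE k S I J)
      (hJ : decide (k ∈ I) = true ∨ J ∈ L.faces) : R S I :=
    outerPart_le_iff.2 ⟨h.1, hJ.imp of_decide_eq_true
      (L.faces.lower fun j hj => h.2 j (mem_blockPart.1 hj))⟩
  let leg (f : Fin (n + m - 1) → Arrow C) (J : Finset (Fin m)) (I : Finset (Fin n))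
      (h : decide (k ∈ I) = true ∨ J ∈ L.faces) :=
    slotCubeMap k f (le_refl I) (edgeLeg L (fun j => f (blockIdx k j)) J (decide (k ∈ I)) h)
  let θ (f : Fin (n + m - 1) → Arrow C) (S I) (h : R S I) :
      cube f S ⟶ cube ((insertFunctor k L).obj f) I :=
    regroup f (hparts h) ≫ leg f _ I (hface h) ≫ (o f I).hom
  -- the trace of `S` on the block may be replaced by any larger admissible subset
  have hθ (f : Fin (n + m - 1) → Arrow C) {S I J} (h : PartsLE k S I J)
      (hJ : decide (k ∈ I) = true ∨ J ∈ L.faces) :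
      θ f S I (hR' h hJ) = regroup f h ≫ leg f J I hJ ≫ (o f I).hom := by
    have hle : blockPart k S ≤ J := fun j hj => h.2 j (mem_blockPart.1 hj)
    simp only [θ, leg]
    rw [← regroup_slotCubeMap f le_rfl hle (hparts (hR' h hJ)) h, Category.assoc,
      ← Category.assoc (slotCubeMap k f _ (cubeMap _ hle)), slotCubeMap_comp, cubeMap_edgeLeg]
  have map_θ (f : Fin (n + m - 1) → Arrow C) {S S' I} (hS : S' ≤ S) (h : R S I) :
      cubeMap f hS ≫ θ f S I h = θ f S' I (hR hS le_rfl h) := by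
    have h' : PartsLE k S' I (blockPart k S) :=
      ⟨fun i hi hi' => (hparts h).1 i hi (hS hi'), fun j hj => (hparts h).2 j (hS hj)⟩
    rw [hθ f h' (hface h), ← cubeMap_regroup f hS (hparts h) h', Category.assoc]
  have θ_map (f : Fin (n + m - 1) → Arrow C) {S I I'} (hI : I ≤ I') (h : R S I) :
      θ f S I h ≫ cubeMap _ hI = θ f S I' (hR le_rfl hI h) := by
    simp only [θ, leg]
    rw [Category.assoc, Category.assoc, o_cubeMap, ← Category.assoc (slotCubeMap _ _ _ _),
      slotCubeMap_comp, edgeLeg_edgeHom L _ _ _ (hface (hR le_rfl hI h)),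
      ← regroup_slotCubeMap f hI le_rfl (hparts h), Category.assoc,
      ← Category.assoc (slotCubeMap _ _ _ _), slotCubeMap_comp, cubeMap_edgeLeg]
  have θ_naturality {f g : Fin (n + m - 1) → Arrow C} (φ : ∀ i, f i ⟶ g i) (S I) (h : R S I) :
      cubeNat φ S ≫ θ g S I h = θ f S I h ≫ cubeNat (insertMap k L (f := f) (g := g) φ) I := by
    simp only [θ, leg]
    rw [← Category.assoc, regroup_naturality, Category.assoc, Category.assoc, Category.assoc,
      o_naturality, ← Category.assoc (slotCubeNat _ _ _ _), ← Category.assoc (slotCubeMap _ _ _ _),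
      slotCubeNat_slotCubeMap k φ (le_refl I)
        (edgeLeg_naturality L (fun j => φ (blockIdx k j)) _ _ (hface h))]
  have huniv : R Finset.univ Finset.univ := Finset.subset_univ _
  have hLE : LEParts k (Finset.univ : Finset (Fin (n + m - 1))) Finset.univ
      (Finset.univ : Finset (Fin m)) :=
    ⟨fun _ _ _ => Finset.mem_univ _, fun _ _ => Finset.mem_univ _⟩
  have hPLE : PartsLE k (Finset.univ : Finset (Fin (n + m - 1))) Finset.univ
      (Finset.univ : Finset (Fin m)) :=
    ⟨fun _ _ _ => Finset.mem_univ _, fun _ _ => Finset.mem_univ _⟩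
  have htop : decide (k ∈ Finset.univ) = true := by simp
  refine exists_polyFunctor_iso False _ K (insertFunctor k L) R hR θ map_θ θ_map θ_naturality
    (fun S hS => ⟨_, mem_comp_faces_iff.1 hS, le_rfl, fun _ h => h⟩)
    (fun I hI S h => mem_comp_faces_iff.2 (K.faces.lower h hI)) ?_ huniv ?_ ?_
  · intro f I hI T t ht
    have hP (J : Finset (Fin m)) : PartsLE k (glue k I J) I J :=
      ⟨fun i hi => (outIdx_mem_glue hi).1, fun j => blockIdx_mem_glue.1⟩
    have hL (J : Finset (Fin m)) : LEParts k (glue k I J) I J :=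
      ⟨fun i hi => (outIdx_mem_glue hi).2, fun j => blockIdx_mem_glue.2⟩
    have hglue {J J' : Finset (Fin m)} (hJ : J' ≤ J) : glue k I J' ≤ glue k I J :=
      le_glue (hP J').1 ((blockPart_glue k I J').le.trans hJ)
    obtain ⟨d, hd, hd'⟩ := existsUnique_edgeLeg_slot L (fun j => f (blockIdx k j))
      (decide (k ∈ I)) _ _ (fun J h => ungroup f (hL J) ≫ t (glue k I J) (hR' (hP J) h))
      (fun J J' hJ h => by
        have hL' : LEParts k (glue k I J) I J' := ⟨(hL J).1, fun j hj => (hL J).2 j (hJ hj)⟩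
        rw [← slotCubeMap_refl k f, ← Category.assoc,
          slotCubeMap_ungroup f le_rfl hJ (hL J) hL', ← ht _ _ (hglue hJ) (hR' (hP J) h),
          ← Category.assoc, ungroup_cubeMap f (hglue hJ) (hL J') hL'])
    simp only [← slotCubeMap_refl k f] at hd hd'
    refine ⟨(o f I).inv ≫ d, fun S h => ?_, fun d' h' => ?_⟩
    · have hS : S ≤ glue k I (blockPart k S) := le_glue (hparts h).1 le_rfl
      simp only [θ, leg, Category.assoc, Iso.hom_inv_id_assoc]
      rw [hd, ← Category.assoc, regroup_ungroup f hS, ht]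
    · rw [Iso.eq_inv_comp]
      refine hd' _ fun J h => ?_
      have := h' _ (hR' (hP J) h)
      rw [← this, hθ f (hP J) h]
      simp only [leg, Category.assoc]
      rw [← Category.assoc (ungroup _ _), ungroup_regroup f le_rfl le_rfl,
        cubeMap_refl, slotCubeMap_id, Category.id_comp]
  · intro f
    have h1 := isIso_regroup f hPLE hLE
    have h2 : IsIso (leg f Finset.univ Finset.univ (Or.inl htop)) :=
      isIso_slotHom _ _ _ (fun _ => isIso_edgeHom _ _ le_rfl) (edgeLeg_univ_isIso L _ htop _)
        fun _ => isIso_edgeHom _ _ le_rfl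
    rw [hθ f hPLE (Or.inl htop)]
    infer_instance
  · intro f
    rw [hθ f hPLE (Or.inl htop)]
    exact .comp _ _ (regroup_structural f hPLE hLE) (.comp _ _
      (.slotHom (fun _ => .edgeHom _ _ _ le_rfl) (edgeLeg_univ_structural L _ _ htop _)
        (fun _ => .edgeHom _ _ _ le_rfl)) (o_structural f))

end Composition

/-! ### The algebra of isomorphism classes of arrows -/

section Algebra

variable {C : Type u} [Category.{v} C]

lemma arrowClass_eq_of_iso {f g : Arrow C} (e : f ≅ g) : arrowClass f = arrowClass g :=
  Quotient.sound ⟨e⟩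

lemma exists_eq_arrowClass {n : ℕ} (x : Fin n → ArrowClass C) :
    ∃ f : Fin n → Arrow C, x = fun i => arrowClass (f i) :=
  ⟨fun i => (x i).out, funext fun i => (Quotient.out_eq (x i)).symm⟩

variable [MonoidalCategory C] [∀ (n : ℕ) (K : NonemptyScpx n), HasColimitsOfShape K.Face C]

/-- The operation on isomorphism classes of arrows induced by `polyMap K`. -/
noncomputable def polyClass {n : ℕ} (K : NonemptyScpx n) (x : Fin n → ArrowClass C) :
    ArrowClass C :=
  arrowClass (polyMap K fun i => (x i).out)

lemma polyClass_arrowClass {n : ℕ} (K : NonemptyScpx n) (f : Fin n → Arrow C) :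
    polyClass K (fun i => arrowClass (f i)) = arrowClass (polyMap K f) := by
  have e (i : Fin n) : Nonempty ((arrowClass (f i)).out ≅ f i) :=
    Quotient.exact (Quotient.out_eq (arrowClass (f i)))
  exact arrowClass_eq_of_iso ((polyFunctor K).mapIso (Pi.isoMk fun i => (e i).some))

variable [SymmetricCategory C]
  [∀ (n : ℕ) (K : NonemptyScpx n) (X : C), PreservesColimitsOfShape K.Face (tensorLeft X)]
  [∀ (n : ℕ) (K : NonemptyScpx n) (X : C), PreservesColimitsOfShape K.Face (tensorRight X)]

/-- The algebra structure over the composition operad on isomorphism classes of arrows. -/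
noncomputable def polyAlgebra : compositionOperad.Algebra (ArrowClass C) where
  map K := polyClass K
  map_act {n} K σ := by
    funext x
    obtain ⟨f, rfl⟩ := exists_eq_arrowClass x
    obtain ⟨e, -⟩ := exists_polyFunctor_act_iso (C := C) K σ
    exact (polyClass_arrowClass (K.act σ) f).trans ((arrowClass_eq_of_iso (e.app f)).trans
      (polyClass_arrowClass K fun i => f (σ⁻¹ i)).symm)
  map_unit := by
    funext x
    obtain ⟨f, rfl⟩ := exists_eq_arrowClass x
    obtain ⟨e, -⟩ := exists_polyFunctor_unit_iso (C := C)
    exact (polyClass_arrowClass NonemptyScpx.unit f).trans (arrowClass_eq_of_iso (e.app f))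
  map_comp {n m} k K L := by
    funext x
    obtain ⟨f, rfl⟩ := exists_eq_arrowClass x
    obtain ⟨e, -⟩ := exists_polyFunctor_comp_iso (C := C) k K L
    obtain ⟨κ, -⟩ := exists_insertFunctor_iso_self (C := C) k L
    refine (polyClass_arrowClass (NonemptyScpx.comp k K L) f).trans
      ((arrowClass_eq_of_iso (e.app f)).trans
        ((polyClass_arrowClass K ((insertFunctor k L).obj f)).symm.trans ?_))
    refine congrArg (polyClass K) (funext fun i => ?_)
    by_cases hi : i = k
    · subst hi
      rw [dif_pos rfl]
      exact (arrowClass_eq_of_iso (κ f).symm).trans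
        (polyClass_arrowClass L fun j => f (blockIdx i j)).symm
    · obtain ⟨ω, -⟩ := exists_insertFunctor_iso (C := C) k L i hi
      rw [dif_neg hi]
      exact arrowClass_eq_of_iso (ω f).symm

end Algebra
theorem theorem3p15 {C : Type u} [Category.{v} C] [MonoidalCategory C] [SymmetricCategory C]
    [∀ (n : ℕ) (K : NonemptyScpx n), HasColimitsOfShape K.Face C]
    [∀ (n : ℕ) (K : NonemptyScpx n) (X : C), PreservesColimitsOfShape K.Face (tensorLeft X)]
    [∀ (n : ℕ) (K : NonemptyScpx n) (X : C), PreservesColimitsOfShape K.Face (tensorRight X)] :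
    (∃ ψ : compositionOperad.Algebra (ArrowClass C),
      ∀ (n : ℕ) (K : NonemptyScpx n) (f : Fin n → Arrow C),
        ψ.map K (fun i => arrowClass (f i)) = arrowClass (polyMap K f)) ∧
    (∃ e : polyFunctor NonemptyScpx.unit ≅ Pi.eval (fun _ : Fin 1 => Arrow C) 0,
      ∀ f, IsStructural False (e.hom.app f).right) ∧
    (∀ (n : ℕ) (K : NonemptyScpx n) (σ : Equiv.Perm (Fin n)),
      ∃ e : polyFunctor (K.act σ) ≅ Pi.comap (fun _ : Fin n => Arrow C) (σ⁻¹ : Equiv.Perm (Fin n)) ⋙ polyFunctor K,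
        ∀ f, IsStructural True (e.hom.app f).right) ∧
    (∀ (n m : ℕ) (k : Fin n) (K : NonemptyScpx n) (L : NonemptyScpx m),
      ∃ e : polyFunctor (C := C) (NonemptyScpx.comp k K L) ≅ insertFunctor k L ⋙ polyFunctor K,
        ∀ f, IsStructural False (e.hom.app f).right) := by
  exact ⟨⟨polyAlgebra, fun n K f => polyClass_arrowClass K f⟩, exists_polyFunctor_unit_iso,
    fun n K σ => exists_polyFunctor_act_iso K σ, fun n m k K L => exists_polyFunctor_comp_iso k K L⟩
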